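/- Let $q$ be a prime power. An $\mathbb{F}_q$-variety is a reduced separated scheme of finite type over $\mathbb{F}_q$; let $K_0(\mathrm{Var}_{\mathbb{F}_q})$ be the Grothendieck ring of $\mathbb{F}_q$-varieties, write $[X]$ for the class of $X$ in it, and put $\mathbb{L}=[\mathbb{A}^1_{\mathbb{F}_q}]$. Let $\mathsf{Gr}^{\mathsf{dc}}(r,n;\mathbb{F}_q)$ be the distinct column locus of the Grassmannian, i.e. the open subvariety of $\mathsf{Gr}(r,n;\mathbb{F}_q)$ of those $r$-dimensional subspaces of $n$-space that are row spaces of $r\times n$ matrices whose columns are pairwise distinct and not identically zero. Let $\mathsf{Conf}_m(X)$ be the configuration space of ordered $m$-tuples of distinct points of a variety $X$ (so $\mathsf{Conf}_0(X)=\operatorname{Spec}\mathbb{F}_q$). Proposition 4.2. For all $r\ge 1$ and $n\ge r+1$, the following identity holds in $K_0(\mathrm{Var}_{\mathbb{F}_q})$: $$[\mathsf{Gr}^{\mathsf{dc}}(r+1,n;\mathbb{F}_q)]=\sum_{k=r+1}^{n}[\mathsf{Gr}^{\mathsf{dc}}(r,k-1;\mathbb{F}_q)]\cdot[\mathsf{Conf}_{n-k}(\mathbb{A}^{r+1}_{\mathbb{F}_q}\setminus\{k+1\text{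 points}\})].$$ Here, for each $k$ with $k+1\le q^{r+1}$, the $k+1$ points are any $k+1$ distinct $\mathbb{F}_q$-rational points of $\mathbb{A}^{r+1}_{\mathbb{F}_q}$ (the identity holds for every choice). For $k+1>q^{r+1}$ there are no $k+1$ such points, and the second factor stands for $\prod_{j=k+1}^{n}(\mathbb{L}^{r+1}-j)$ (which is $1$ for $k=n$). -/

import Mathlib

universe u

noncomputable section

namespace KZero

open AlgebraicGeometry CategoryTheory CategoryTheory.Limits TopologicalSpace

/-- The reduced induced structure on a closed subset of a scheme is reduced. -/
instance isReduced_vanishingIdeal_subscheme (X : Scheme.{u}) (Z : Closeds X) :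
    IsReduced (Scheme.IdealSheafData.vanishingIdeal Z).subscheme := by
  let I := Scheme.IdealSheafData.vanishingIdeal Z
  have (U : X.affineOpens) : IsReduced (I.subschemeCover.openCover.X U) := by
    have : _root_.IsReduced (Γ(X, U.1) ⧸ I.ideal U) := by
      rw [← Ideal.isRadical_iff_quotient_reduced]
      exact PrimeSpectrum.isRadical_vanishingIdeal _
    exact inferInstanceAs (IsReduced (Spec (CommRingCat.of (Γ(X, U.1) ⧸ I.ideal U))))
  have (i : I.subschemeCover.openCover.I₀) : IsReduced (I.subschemeCover.openCover.X i) := this i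
  exact IsReduced.of_openCover _ I.subschemeCover.openCover

/-- An `F`-variety: a reduced separated scheme of finite type over the field `F`. -/
structure Variety (F : Type u) [Field F] where
  /-- the underlying scheme -/
  X : Scheme.{u}
  /-- the structure morphism -/
  str : X ⟶ Spec (.of F)
  [isReduced : IsReduced X]
  [isSeparated : IsSeparated str]
  [locallyOfFiniteType : LocallyOfFiniteType str]
  [quasiCompact : QuasiCompact str]

attribute [instance] Variety.isReduced Variety.isSeparated Variety.locallyOfFiniteType
  Variety.quasiCompact

namespace Variety

variable {F : Type u} [Field F]

/-- A closed subset `Z` of a separated scheme `X` of finite type over `F`, with its reduced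
structure. -/
def ofClosed {X : Scheme.{u}} (f : X ⟶ Spec (.of F)) [IsSeparated f] [LocallyOfFiniteType f]
    [QuasiCompact f] (Z : Closeds X) : Variety F where
  X := (Scheme.IdealSheafData.vanishingIdeal Z).subscheme
  str := (Scheme.IdealSheafData.vanishingIdeal Z).subschemeι ≫ f

theorem isNoetherian (V : Variety F) : IsNoetherian V.X := by
  have : IsLocallyNoetherian V.X := LocallyOfFiniteType.isLocallyNoetherian V.str
  have : CompactSpace V.X := QuasiCompact.compactSpace_of_compactSpace V.str
  exact {}

/-- An open subset `U` of a variety, as an open subvariety. -/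
def openSub (V : Variety F) (U : V.X.Opens) : Variety F :=
  have := V.isNoetherian
  { X := U.toScheme
    str := U.ι ≫ V.str }

/-- The point `Spec F`. -/
def point (F : Type u) [Field F] : Variety F where
  X := Spec (.of F)
  str := 𝟙 _

/-- The product of two varieties: the fibre product over `F` with its reduced structure. (Over a
perfect field, such as a finite field, the fibre product is already reduced.) -/
def prod (V W : Variety F) : Variety F :=
  ofClosed (pullback.fst V.str W.str ≫ V.str) ⊤

/-- The first projection. -/
def fst (V W : Variety F) : (V.prod W).X ⟶ V.X :=
  (Scheme.IdealSheafData.vanishingIdeal ⊤).subschemeι ≫ pullback.fst V.str W.str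

/-- The second projection. -/
def snd (V W : Variety F) : (V.prod W).X ⟶ W.X :=
  (Scheme.IdealSheafData.vanishingIdeal ⊤).subschemeι ≫ pullback.snd V.str W.str

theorem fst_str (V W : Variety F) : V.fst W ≫ V.str = (V.prod W).str := by
  simp [fst, prod, ofClosed]

theorem snd_str (V W : Variety F) : V.snd W ≫ W.str = (V.prod W).str := by
  simp [snd, prod, ofClosed, pullback.condition]

/-- The power `V ^ m`, the product of `m` copies of `V` over `F`. -/
def pow (V : Variety F) : ℕ → Variety F
  | 0 => point F
  | m + 1 => (pow V m).prod V

/-- The `i`-th coordinate `V ^ m ⟶ V`, for `i < m`. -/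
def coord (V : Variety F) : (m : ℕ) → Fin m → ((V.pow m).X ⟶ V.X)
  | 0 => fun i => i.elim0
  | m + 1 => Fin.lastCases ((V.pow m).snd V) (fun i => (V.pow m).fst V ≫ coord V m i)

theorem coord_last (V : Variety F) (m : ℕ) :
    V.coord (m + 1) (Fin.last m) = (V.pow m).snd V :=
  Fin.lastCases_last (motive := fun _ => (V.pow (m + 1)).X ⟶ V.X)

theorem coord_castSucc (V : Variety F) (m : ℕ) (i : Fin m) :
    V.coord (m + 1) i.castSucc = (V.pow m).fst V ≫ V.coord m i :=
  Fin.lastCases_castSucc (motive := fun _ => (V.pow (m + 1)).X ⟶ V.X) i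

theorem coord_str (V : Variety F) (m : ℕ) (i : Fin m) :
    V.coord m i ≫ V.str = (V.pow m).str := by
  induction m with
  | zero => exact i.elim0
  | succ m ih =>
    refine Fin.lastCases ?_ (fun i => ?_) i
    · rw [coord_last]
      exact snd_str (V.pow m) V
    · rw [coord_castSucc]
      exact (Category.assoc _ _ _).trans ((congrArg _ (ih i)).trans (fst_str (V.pow m) V))

/-- The locus in `V ^ m` where the `i`-th and the `j`-th coordinates agree: the preimage of the
diagonal of `V ×_F V`. -/
def bigDiagonal (V : Variety F) (m : ℕ) (i j : Fin m) : Set (V.pow m).X :=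
  pullback.lift (V.coord m i) (V.coord m j) ((V.coord_str m i).trans (V.coord_str m j).symm) ⁻¹'
    Set.range (pullback.diagonal V.str)

theorem isClosed_bigDiagonal (V : Variety F) (m : ℕ) (i j : Fin m) :
    IsClosed (V.bigDiagonal m i j) :=
  (pullback.diagonal V.str).isClosedEmbedding.isClosed_range.preimage (Scheme.Hom.continuous _)

/-- The configuration space of ordered `m`-tuples of distinct points of `V`: the open subvariety of
`V ^ m` where no two coordinates agree. -/
def conf (m : ℕ) (V : Variety F) : Variety F :=
  (V.pow m).openSub
    ⟨{x | ∀ i j, i ≠ j → x ∉ V.bigDiagonal m i j}, by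
      simp only [Set.ofPred_forall]
      exact isOpen_iInter_of_finite fun i => isOpen_iInter_of_finite fun j =>
        isOpen_iInter_of_finite fun _ => (V.isClosed_bigDiagonal m i j).isOpen_compl⟩

/-- Affine space of dimension `d` over `F`. -/
def affineSpace (F : Type u) [Field F] (d : ℕ) : Variety F where
  X := Spec (.of (MvPolynomial (Fin d) F))
  str := Spec.map (CommRingCat.ofHom (algebraMap F (MvPolynomial (Fin d) F)))
  locallyOfFiniteType := by
    rw [HasRingHomProperty.Spec_iff (P := @LocallyOfFiniteType)]
    exact RingHom.finiteType_algebraMap.2 inferInstance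

/-- The closed point of affine space given by a vector `a ∈ F ^ d`: its ideal consists of the
polynomials that vanish at `a`. -/
def ratPoint {d : ℕ} (a : Fin d → F) : (affineSpace F d).X :=
  (⟨RingHom.ker (MvPolynomial.eval a), RingHom.ker_isPrime _⟩ :
    PrimeSpectrum (MvPolynomial (Fin d) F))

theorem isClosed_ratPoint {d : ℕ} (a : Fin d → F) :
    IsClosed ({ratPoint a} : Set (affineSpace F d).X) := by
  refine (PrimeSpectrum.isClosed_singleton_iff_isMaximal _).2 ?_
  exact RingHom.ker_isMaximal_of_surjective _ fun c => ⟨MvPolynomial.C c, by simp⟩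

/-- Affine space of dimension `d` with a finite set `S` of `F`-rational points removed. -/
def affineMinus {d : ℕ} (S : Finset (Fin d → F)) : Variety F :=
  (affineSpace F d).openSub
    ⟨{x | ∀ a ∈ S, x ≠ ratPoint a}, by
      simp only [Set.ofPred_forall]
      exact S.finite_toSet.isOpen_biInter fun a _ => (isClosed_ratPoint a).isOpen_compl⟩

section Grassmannian

attribute [local instance] MvPolynomial.gradedAlgebra

/-- The projective space over `F` with one homogeneous coordinate `p_f` for each
`f : Fin r → Fin n`. -/
abbrev pluckerSpace (F : Type u) [Field F] (r n : ℕ) : Scheme.{u} :=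
  Proj (MvPolynomial.homogeneousSubmodule (Fin r → Fin n) F)

/-- The structure morphism of this projective space. -/
def pluckerSpaceStr (F : Type u) [Field F] (r n : ℕ) : pluckerSpace F r n ⟶ Spec (.of F) :=
  Proj.toSpecZero (MvPolynomial.homogeneousSubmodule (Fin r → Fin n) F) ≫
    Spec.map (CommRingCat.ofHom
      (algebraMap F (MvPolynomial.homogeneousSubmodule (Fin r → Fin n) F 0)))

/-- The minor of the generic `r × n` matrix formed by the columns `f 0, …, f (r - 1)`, in this
order. -/
def genericMinor (F : Type u) [Field F] {r n : ℕ} (f : Fin r → Fin n) :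
    MvPolynomial (Fin r × Fin n) F :=
  Matrix.det (Matrix.of fun a b => MvPolynomial.X (a, f b))

/-- The homogeneous polynomial relations that hold among the maximal minors of the generic `r × n`
matrix. -/
def pluckerRelations (F : Type u) [Field F] (r n : ℕ) : Set (MvPolynomial (Fin r → Fin n) F) :=
  {g | (∃ d, g.IsHomogeneous d) ∧ MvPolynomial.aeval (genericMinor F) g = 0}

theorem surjective_algebraMap_zero (F : Type u) [Field F] (r n : ℕ) : Function.Surjective
    (algebraMap F (MvPolynomial.homogeneousSubmodule (Fin r → Fin n) F 0)) := by
  rintro ⟨x, hx⟩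
  have hx' : x.totalDegree = 0 := Nat.le_zero.1 (MvPolynomial.IsHomogeneous.totalDegree_le hx)
  exact ⟨x.coeff 0, Subtype.ext (MvPolynomial.totalDegree_eq_zero_iff_eq_C.1 hx').symm⟩

instance (r n : ℕ) : Algebra.FiniteType
    (MvPolynomial.homogeneousSubmodule (Fin r → Fin n) F 0)
    (MvPolynomial (Fin r → Fin n) F) :=
  have : IsScalarTower F (MvPolynomial.homogeneousSubmodule (Fin r → Fin n) F 0)
      (MvPolynomial (Fin r → Fin n) F) :=
    ⟨fun a b c => by simp [Algebra.smul_def, mul_assoc]⟩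
  Algebra.FiniteType.of_restrictScalars_finiteType F _ _

instance (r n : ℕ) : IsSeparated (pluckerSpaceStr F r n) := by
  unfold pluckerSpaceStr
  infer_instance

instance (r n : ℕ) : LocallyOfFiniteType (pluckerSpaceStr F r n) := by
  have : LocallyOfFiniteType (Spec.map (CommRingCat.ofHom
      (algebraMap F (MvPolynomial.homogeneousSubmodule (Fin r → Fin n) F 0)))) := by
    rw [HasRingHomProperty.Spec_iff (P := @LocallyOfFiniteType)]
    exact RingHom.FiniteType.of_surjective _ (surjective_algebraMap_zero F r n)
  unfold pluckerSpaceStr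
  infer_instance

instance (r n : ℕ) : QuasiCompact (pluckerSpaceStr F r n) := by
  unfold pluckerSpaceStr
  infer_instance

/-- The Grassmannian of `r`-dimensional subspaces of `F ^ n`, in its Plücker embedding: the row
space of a matrix `A` of rank `r` is the point whose coordinate `p_f` is the minor of `A` on the
columns `f 0, …, f (r - 1)`. We allow all tuples `f`, not only the increasing ones; the additional
coordinates are `0` or up to sign equal to one with `f` increasing, and these equalities are among
the relations imposed. -/
def grassmannian (F : Type u) [Field F] (r n : ℕ) : Variety F :=
  ofClosed (pluckerSpaceStr F r n)
    ⟨ProjectiveSpectrum.zeroLocus _ (pluckerRelations F r n),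
      ProjectiveSpectrum.isClosed_zeroLocus _ _⟩

/-- The inclusion of the Grassmannian into projective space. -/
def grassmannianι (F : Type u) [Field F] (r n : ℕ) :
    (grassmannian F r n).X ⟶ pluckerSpace F r n :=
  (Scheme.IdealSheafData.vanishingIdeal _).subschemeι

/-- The open set of projective space that cuts out the distinct column locus. For the row space of
a matrix `A` of rank `r`, the `i`-th column of `A` is zero if and only if all the minors
that involve it vanish; the `i`-th and `j`-th columns agree if and only if replacing one by the
other never changes a minor. -/
def distinctColumns (F : Type u) [Field F] (r n : ℕ) : (pluckerSpace F r n).Opens where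
  carrier := {x |
    (∀ i : Fin n, ∃ f : Fin r → Fin n, i ∈ Set.range f ∧
      x ∈ Proj.basicOpen _ (MvPolynomial.X (R := F) f)) ∧
    ∀ i j : Fin n, i ≠ j → ∃ (f : Fin r → Fin n) (a : Fin r),
      x ∈ Proj.basicOpen _ (MvPolynomial.X (R := F) (Function.update f a i) -
        MvPolynomial.X (Function.update f a j))}
  is_open' := by
    simp only [Set.ofPred_and, Set.ofPred_forall, Set.ofPred_exists]
    refine IsOpen.inter (isOpen_iInter_of_finite fun i => isOpen_iUnion fun f => ?_)
      (isOpen_iInter_of_finite fun i => isOpen_iInter_of_finite fun j =>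
        isOpen_iInter_of_finite fun _ => isOpen_iUnion fun f => isOpen_iUnion fun a =>
          (Proj.basicOpen _ _).isOpen)
    exact isOpen_const.inter (Proj.basicOpen _ _).isOpen

/-- `Gr^dc(r, n)`: the distinct column locus of the Grassmannian, an open subvariety. -/
def grdc (F : Type u) [Field F] (r n : ℕ) : Variety F :=
  (grassmannian F r n).openSub (grassmannianι F r n ⁻¹ᵁ distinctColumns F r n)

end Grassmannian

end Variety

open Variety

/-- The defining relations of the Grothendieck ring of varieties, in the polynomial ring on the
symbols `[V]`. -/
inductive Rel (F : Type u) [Field F] : MvPolynomial (Variety F) ℤ → Prop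
  /-- isomorphic varieties have the same class -/
  | iso (V W : Variety F) (e : V.X ≅ W.X) (he : e.hom ≫ W.str = V.str) :
      Rel F (.X V - .X W)
  /-- `[V] = [Z] + [V ∖ Z]` for `Z` closed in `V` -/
  | scissor (V : Variety F) (Z : Closeds V.X) :
      Rel F (.X V - (.X (ofClosed V.str Z) + .X (V.openSub Z.compl)))
  /-- `[V] [W] = [V × W]` -/
  | prod (V W : Variety F) : Rel F (.X V * .X W - .X (V.prod W))
  /-- `[Spec F] = 1` -/
  | one : Rel F (.X (point F) - 1)

/-- The Grothendieck ring `K₀(Var_F)`. By the last two relations every monomial in the symbols `[V]`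
is the class of a variety, so as an additive group this is the free abelian group on
isomorphism classes of varieties modulo the scissor relations, with the product `[V] [W] = [V × W]`
and the unit `[Spec F]`. -/
abbrev K0 (F : Type u) [Field F] : Type (u + 1) :=
  MvPolynomial (Variety F) ℤ ⧸ Ideal.span {p | Rel F p}

/-- The class `[V]` of a variety in the Grothendieck ring. -/
def cls {F : Type u} [Field F] (V : Variety F) : K0 F :=
  Ideal.Quotient.mk _ (MvPolynomial.X V)

end KZero

end

/-! Both sides are computed as polynomials in `L = [𝔸¹]`. A subspace has a unique reduced row
echelon matrix, and whether the columns are distinct and nonzero does not depend on the matrix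
chosen. So the distinct column locus is stratified by the pivot set, which is the lexicographically
first tuple with nonvanishing Plücker coordinate (`image_echelonMap`).

A stratum is built column by column, counting columns from 0. A pivot column is automatically new. A
non-pivot column `c` ranges over an affine space of dimension `#{pivots < c}` and has to avoid the
zero vector and the `c` earlier columns, all of which lie in that space; this gives the factor `L ^
#{pivots < c} - (c + 1)`. Summing over pivot sets gives `cls_grdc_eq_echelonSum`.

Now sort the sets of `r + 1` pivots by their last element `k - 1`. The columns before it contribute
the terms of `[Gr^dc(r, k - 1)]`. Each column after it sees all `r + 1` pivots on its left, so
together these contribute the product of `L ^ (r + 1) - j` for `k + 1 ≤ j ≤ n`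
(`echelonSum_eq_sum`). The same product is the class of the configuration space: its points are
chosen one after another, away from the `k + 1` removed points and from each other
(`cls_conf_affineMinus`).

Both computations rest on `cls_eq_of_compl_graphs`: the complement in `B × V` of `N` pairwise
disjoint graphs has class `[B] ([V] - N)`. Its hypotheses are tested on field-valued points. This
suffices because the varieties are reduced and separated: an immersed variety is determined by its
image (`exists_iso_of_range_eq`), and agreement of morphisms is detected on points
(`mem_eqLocus_iff`). -/

noncomputable section

namespace KZero

open AlgebraicGeometry CategoryTheory CategoryTheory.Limits TopologicalSpace

/-! ### Immersions of reduced schemes are determined by their image -/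

section Immersion

theorem range_comp {X Y Z : Scheme.{u}} (f : X ⟶ Y) (g : Y ⟶ Z) :
    Set.range (f ≫ g) = g '' Set.range f := by
  rw [← Set.range_comp]
  congr 1

/-- The range is everything, hence closed, so the immersion is closed; a surjective closed immersion
into a reduced scheme has zero ideal. -/
theorem isIso_of_isImmersion_of_surjective {X Y : Scheme.{u}} (f : X ⟶ Y) [IsImmersion f]
    [Surjective f] [IsReduced Y] : IsIso f := by
  have h : IsClosedImmersion f :=
    .of_isPreimmersion f (by rw [f.surjective.range_eq]; exact isClosed_univ)
  exact isIso_of_isClosedImmersion_of_surjective f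

theorem surjective_pullback_fst_of_range_subset {X Y Z : Scheme.{u}} (f : X ⟶ Z) (g : Y ⟶ Z)
    (h : Set.range f ⊆ Set.range g) : Surjective (pullback.fst f g) := by
  refine ⟨fun x => ?_⟩
  obtain ⟨y, hy⟩ := h ⟨x, rfl⟩
  obtain ⟨z, hz, -⟩ := Scheme.Pullback.exists_preimage_pullback (f := f) (g := g) x y hy.symm
  exact ⟨z, hz⟩

/-- Two immersions from reduced schemes with the same range have isomorphic sources. -/
theorem exists_iso_of_range_eq {X Y Z : Scheme.{u}} (f : X ⟶ Z) (g : Y ⟶ Z) [IsImmersion f]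
    [IsImmersion g] [IsReduced X] [IsReduced Y] (h : Set.range f = Set.range g) :
    ∃ e : X ≅ Y, e.hom ≫ g = f := by
  have := surjective_pullback_fst_of_range_subset f g h.subset
  have := surjective_pullback_fst_of_range_subset g f h.superset
  have : Surjective (pullback.snd f g) := by
    rw [← pullbackSymmetry_hom_comp_fst]
    infer_instance
  -- Each projection of the fibre product is an immersion, as a base change, and is surjective
  -- because the ranges agree; so both are isomorphisms onto the reduced schemes `X` and `Y`.
  have h1 := isIso_of_isImmersion_of_surjective (pullback.fst f g)
  have h2 := isIso_of_isImmersion_of_surjective (pullback.snd f g)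
  refine ⟨(asIso (pullback.fst f g)).symm ≪≫ asIso (pullback.snd f g), ?_⟩
  simp [pullback.condition]

end Immersion

namespace Variety

variable {F : Type u} [Field F]

/-! ### Classes of locally closed subsets and their additivity -/

section LocallyClosed

variable {X : Scheme.{u}} (f : X ⟶ Spec (.of F)) [IsSeparated f] [LocallyOfFiniteType f]
  [QuasiCompact f]

/-- The inclusion of a closed subset with its reduced structure. -/
def ofClosedι (Z : Closeds X) : (ofClosed f Z).X ⟶ X :=
  (Scheme.IdealSheafData.vanishingIdeal Z).subschemeι

instance (Z : Closeds X) : IsClosedImmersion (ofClosedι f Z) :=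
  inferInstanceAs (IsClosedImmersion (Scheme.IdealSheafData.vanishingIdeal Z).subschemeι)

theorem ofClosedι_str (Z : Closeds X) : ofClosedι f Z ≫ f = (ofClosed f Z).str := rfl

theorem range_ofClosedι (Z : Closeds X) : Set.range (ofClosedι f Z) = Z := by
  refine (Scheme.IdealSheafData.range_subschemeι (Scheme.IdealSheafData.vanishingIdeal Z)).trans ?_
  simp

/-- The inclusion of an open subvariety. -/
def openSubι (V : Variety F) (U : V.X.Opens) : (V.openSub U).X ⟶ V.X := U.ι

instance (V : Variety F) (U : V.X.Opens) : IsOpenImmersion (openSubι V U) :=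
  inferInstanceAs (IsOpenImmersion U.ι)

theorem openSubι_str (V : Variety F) (U : V.X.Opens) :
    openSubι V U ≫ V.str = (V.openSub U).str := rfl

theorem range_openSubι (V : Variety F) (U : V.X.Opens) : Set.range (openSubι V U) = U :=
  U.range_ι

/-- The reduced subvariety on a locally closed subset `C`. -/
def ofLocallyClosed (C : Set X) : Variety F :=
  (ofClosed f ⟨closure C, isClosed_closure⟩).openSub
    -- The coborder of a locally closed set is already open; taking the interior makes the
    -- definition total.
    (ofClosedι f _ ⁻¹ᵁ ⟨interior (coborder C), isOpen_interior⟩)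

/-- The inclusion of the subvariety on a locally closed subset. -/
def ofLocallyClosedι (C : Set X) : (ofLocallyClosed f C).X ⟶ X :=
  openSubι _ _ ≫ ofClosedι f _

instance (C : Set X) : IsImmersion (ofLocallyClosedι f C) :=
  IsImmersion.comp (openSubι (ofClosed f ⟨closure C, isClosed_closure⟩)
    (ofClosedι f _ ⁻¹ᵁ ⟨interior (coborder C), isOpen_interior⟩)) (ofClosedι f _)

theorem ofLocallyClosedι_str (C : Set X) :
    ofLocallyClosedι f C ≫ f = (ofLocallyClosed f C).str := by
  unfold ofLocallyClosedι ofLocallyClosed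
  rw [Category.assoc, ofClosedι_str, openSubι_str]

theorem range_ofLocallyClosedι {C : Set X} (hC : IsLocallyClosed C) :
    Set.range (ofLocallyClosedι f C) = C := by
  refine (range_comp (openSubι (ofClosed f ⟨closure C, isClosed_closure⟩)
    (ofClosedι f _ ⁻¹ᵁ ⟨interior (coborder C), isOpen_interior⟩)) (ofClosedι f _)).trans ?_
  rw [range_openSubι]
  refine (Set.image_preimage_eq_inter_range (f := ofClosedι f ⟨closure C, isClosed_closure⟩)
    (t := interior (coborder C))).trans ?_
  rw [range_ofClosedι]
  change interior (coborder C) ∩ closure C = C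
  rw [hC.isOpen_coborder.interior_eq, coborder_inter_closure]

/-- The class of a locally closed subset. -/
def locCls (C : Set X) : K0 F := cls (ofLocallyClosed f C)

end LocallyClosed

theorem cls_eq_of_iso {V W : Variety F} (e : V.X ≅ W.X) (he : e.hom ≫ W.str = V.str) :
    cls V = cls W := by
  unfold cls
  rw [Ideal.Quotient.eq]
  exact Ideal.subset_span (Rel.iso V W e he)

theorem cls_scissor (V : Variety F) (Z : Closeds V.X) :
    cls V = cls (ofClosed V.str Z) + cls (V.openSub Z.compl) := by
  unfold cls
  rw [← map_add, Ideal.Quotient.eq]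
  exact Ideal.subset_span (Rel.scissor V Z)

theorem cls_prod (V W : Variety F) : cls V * cls W = cls (V.prod W) := by
  unfold cls
  rw [← map_mul, Ideal.Quotient.eq]
  exact Ideal.subset_span (Rel.prod V W)

theorem cls_point : cls (point F) = 1 := by
  unfold cls
  rw [← map_one (Ideal.Quotient.mk _), Ideal.Quotient.eq]
  exact Ideal.subset_span Rel.one

section LocallyClosed

variable {X : Scheme.{u}} (f : X ⟶ Spec (.of F)) [IsSeparated f] [LocallyOfFiniteType f]
  [QuasiCompact f]

theorem isLocallyClosed_range {Y Z : Scheme.{u}} (j : Y ⟶ Z) [IsImmersion j] :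
    IsLocallyClosed (Set.range j) := j.isLocallyClosed_range

/-- A variety that is immersed in `X` has the class of its image. -/
theorem cls_eq_locCls (V : Variety F) (j : V.X ⟶ X) [IsImmersion j] (hj : j ≫ f = V.str) :
    cls V = locCls f (Set.range j) := by
  have hC := isLocallyClosed_range j
  obtain ⟨e, he⟩ := exists_iso_of_range_eq j (ofLocallyClosedι f (Set.range j))
    (range_ofLocallyClosedι f hC).symm
  refine cls_eq_of_iso e ?_
  rw [← ofLocallyClosedι_str, ← Category.assoc, he, hj]

theorem locCls_self (V : Variety F) : locCls V.str Set.univ = cls V := by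
  rw [cls_eq_locCls V.str V (𝟙 _) (Category.id_comp _)]
  congr 1
  exact (Set.range_eq_univ.2 fun x => ⟨x, rfl⟩).symm

/-- Additivity of the class for a closed subset of a locally closed subset and its complement. -/
theorem locCls_eq_add {C Z : Set X} (hC : IsLocallyClosed C) (hZ : IsClosed Z) :
    locCls f C = locCls f (C ∩ Z) + locCls f (C \ Z) := by
  let ι := ofLocallyClosedι f C
  have hι : Set.range ι = C := range_ofLocallyClosedι f hC
  let Z' : Closeds (ofLocallyClosed f C).X := ⟨ι ⁻¹' Z, hZ.preimage ι.continuous⟩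
  rw [locCls, cls_scissor _ Z',
    cls_eq_locCls f (ofClosed _ Z') (ofClosedι _ Z' ≫ ι)
      (by rw [Category.assoc, ofLocallyClosedι_str, ofClosedι_str]),
    cls_eq_locCls f ((ofLocallyClosed f C).openSub Z'.compl) (openSubι _ _ ≫ ι)
      (by rw [Category.assoc, ofLocallyClosedι_str, openSubι_str])]
  congr 2
  · rw [range_comp, range_ofClosedι]
    change ι '' (ι ⁻¹' Z) = _
    rw [Set.image_preimage_eq_inter_range, hι, Set.inter_comm]
  · rw [range_comp, range_openSubι]
    change ι '' (ι ⁻¹' Zᶜ) = _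
    rw [Set.image_preimage_eq_inter_range, hι, Set.inter_comm, Set.sdiff_eq]

/-- Cutting the empty set into two empty pieces gives `x = x + x`. -/
theorem locCls_empty : locCls f (∅ : Set X) = 0 := by
  have h := locCls_eq_add f (C := ∅) (Z := ∅) isClosed_empty.isLocallyClosed isClosed_empty
  simpa using h

/-- Additivity over the strata of a filtration by finitely many open subsets. -/
theorem locCls_eq_sum {ι : Type*} [LinearOrder ι] (D : ι → Set X)
    (hD : ∀ i, IsOpen (D i)) {C : Set X} (hC : IsLocallyClosed C) (s : Finset ι) :
    locCls f (C ∩ ⋃ i ∈ s, D i) =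
      ∑ i ∈ s, locCls f {x ∈ C | x ∈ D i ∧ ∀ j ∈ s, j < i → x ∉ D j} := by
  induction s using Finset.induction_on_max with
  | empty => simp [locCls_empty]
  | insert a s ha ih =>
    have hs : IsOpen (⋃ i ∈ s, D i) := isOpen_biUnion fun i _ => hD i
    have ha' : a ∉ s := fun h => lt_irrefl _ (ha a h)
    -- Since `a` exceeds every element of `s`, its stratum is the part outside the opens of `s`,
    -- which is closed in the union; what remains is the union over `s`.
    rw [Finset.sum_insert ha',
      locCls_eq_add f (C := C ∩ ⋃ i ∈ insert a s, D i)
        (hC.inter (isOpen_biUnion fun i _ => hD i).isLocallyClosed) hs.isClosed_compl]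
    congr 1
    · congr 1
      ext x
      simp only [Finset.mem_insert, Set.mem_inter_iff, Set.mem_iUnion, Set.mem_compl_iff,
        Set.mem_ofPred_eq]
      constructor
      · rintro ⟨⟨hx, i, rfl | hi, hi'⟩, hn⟩
        · refine ⟨hx, hi', ?_⟩
          rintro j (rfl | hj) hji hj'
          · exact lt_irrefl _ hji
          · exact hn ⟨j, hj, hj'⟩
        · exact absurd ⟨i, hi, hi'⟩ hn
      · rintro ⟨hx, hxa, h⟩
        refine ⟨⟨hx, a, Or.inl rfl, hxa⟩, ?_⟩
        rintro ⟨j, hj, hj'⟩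
        exact h j (Or.inr hj) (ha j hj) hj'
    · rw [show (C ∩ ⋃ i ∈ insert a s, D i) \ (⋃ i ∈ s, D i)ᶜ = C ∩ ⋃ i ∈ s, D i by
        ext x
        simp only [Finset.mem_insert, Set.mem_inter_iff, Set.mem_iUnion, Set.mem_compl_iff,
          Set.mem_sdiff, not_not]
        constructor
        · exact fun h => ⟨h.1.1, h.2⟩
        · rintro ⟨h1, i, hi, hx⟩
          exact ⟨⟨h1, i, Or.inr hi, hx⟩, i, hi, hx⟩, ih]
      refine Finset.sum_congr rfl fun i hi => ?_
      congr 1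
      ext x
      simp only [Finset.mem_insert, Set.mem_ofPred_eq]
      refine and_congr_right fun _ => and_congr_right fun _ => ?_
      constructor
      · rintro h j (rfl | hj) hji
        · exact absurd (hji.trans (ha i hi)) (lt_irrefl _)
        · exact h j hj hji
      · exact fun h j hj => h j (Or.inr hj)

end LocallyClosed

/-! ### The locus where two morphisms agree -/

section Agreement

variable {S T V : Scheme.{u}} {str : V ⟶ S}

/-- The set where two morphisms over `S` agree. -/
def eqLocus (str : V ⟶ S) (a b : T ⟶ V) (h : a ≫ str = b ≫ str) : Set T :=
  pullback.lift a b h ⁻¹' Set.range (pullback.diagonal str)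

theorem mem_eqLocus_comp {T' : Scheme.{u}} (t : T' ⟶ T) (a b : T ⟶ V)
    (h : a ≫ str = b ≫ str) (x : T') :
    x ∈ eqLocus str (t ≫ a) (t ≫ b) (by simp [h]) ↔ t x ∈ eqLocus str a b h := by
  have : pullback.lift (t ≫ a) (t ≫ b) (by simp [h]) = t ≫ pullback.lift a b h := by
    apply pullback.hom_ext <;> simp [pullback.lift_fst, pullback.lift_snd]
  rw [eqLocus, eqLocus, this]
  rfl

theorem eqLocus_eq_univ (a : T ⟶ V) : eqLocus str a a rfl = Set.univ := by
  have : pullback.lift a a rfl = a ≫ pullback.diagonal str := by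
    apply pullback.hom_ext <;> simp [pullback.lift_fst, pullback.lift_snd]
  rw [eqLocus, this]
  exact Set.eq_univ_of_forall fun x => ⟨a x, rfl⟩

theorem eqLocus_eq_univ_of_eq (a b : T ⟶ V) (h : a ≫ str = b ≫ str) (hab : a = b) :
    eqLocus str a b h = Set.univ := by
  subst hab
  exact eqLocus_eq_univ a

/-- The base change of the diagonal along `(a, b)` is a surjective immersion into the reduced scheme
`T`, hence an isomorphism; so `(a, b)` factors through the diagonal. -/
theorem eq_of_eqLocus_eq_univ [IsReduced T] [IsSeparated str] (a b : T ⟶ V)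
    (h : a ≫ str = b ≫ str) (hab : eqLocus str a b h = Set.univ) : a = b := by
  have hs : Surjective (pullback.fst (pullback.lift a b h) (pullback.diagonal str)) := by
    refine surjective_pullback_fst_of_range_subset _ _ ?_
    rintro _ ⟨x, rfl⟩
    exact hab.symm.subset (Set.mem_univ x)
  have hi := isIso_of_isImmersion_of_surjective
    (pullback.fst (pullback.lift a b h) (pullback.diagonal str))
  have hc := pullback.condition (f := pullback.lift a b h) (g := pullback.diagonal str)
  have h1 := congrArg (· ≫ pullback.fst _ _) hc
  have h2 := congrArg (· ≫ pullback.snd _ _) hc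
  simp only [Category.assoc, pullback.lift_fst, pullback.lift_snd, pullback.diagonal_fst,
    pullback.diagonal_snd] at h1 h2
  exact (cancel_epi _).1 (h1.trans h2.symm)

/-- Membership in the locus of agreement, tested on a field-valued point. -/
theorem mem_eqLocus_iff [IsSeparated str] {K : Type u} [Field K] (t : Spec (.of K) ⟶ T)
    (a b : T ⟶ V) (h : a ≫ str = b ≫ str) (p : Spec (.of K)) :
    t p ∈ eqLocus str a b h ↔ t ≫ a = t ≫ b := by
  rw [← mem_eqLocus_comp]
  constructor
  · intro hp
    refine eq_of_eqLocus_eq_univ (str := str) (t ≫ a) (t ≫ b) (by simp [h])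
      (Set.eq_univ_of_forall fun q => ?_)
    rwa [show q = p from Subsingleton.elim (α := PrimeSpectrum K) _ _]
  · intro e
    rw [eqLocus_eq_univ_of_eq _ _ _ e]
    trivial

/-- Every point is the image of a field-valued point. -/
theorem exists_fieldPoint (x : T) :
    ∃ (K : Type u) (_ : Field K) (t : Spec (.of K) ⟶ T) (p : Spec (.of K)), t p = x := by
  refine ⟨T.residueField x, inferInstance, T.fromSpecResidueField x,
    (⊥ : PrimeSpectrum (T.residueField x)), ?_⟩
  exact Scheme.fromSpecResidueField_apply x _

end Agreement

/-! ### Complements of disjoint graphs in a product -/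

section Graphs

variable {B V E : Variety F}

/-- The graph of a morphism of varieties. -/
def graph (s : B.X ⟶ V.X) (hs : s ≫ V.str = B.str) : B.X ⟶ pullback B.str V.str :=
  pullback.lift (𝟙 _) s (by rw [hs, Category.id_comp])

instance (s : B.X ⟶ V.X) (hs : s ≫ V.str = B.str) : IsClosedImmersion (graph s hs) := by
  have : IsClosedImmersion (graph s hs ≫ pullback.fst _ _) := by
    rw [graph, pullback.lift_fst]
    infer_instance
  exact IsClosedImmersion.of_comp _ (pullback.fst _ _)

/-- The locus in the product over `s`. -/
theorem range_graph (s : B.X ⟶ V.X) (hs : s ≫ V.str = B.str) :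
    Set.range (graph s hs) = eqLocus V.str (pullback.fst B.str V.str ≫ s) (pullback.snd _ _)
      (by rw [Category.assoc, hs, pullback.condition]) := by
  apply Set.Subset.antisymm
  · rintro _ ⟨x, rfl⟩
    rw [← mem_eqLocus_comp]
    rw [eqLocus_eq_univ_of_eq]
    · trivial
    · simp [graph, pullback.lift_fst_assoc, pullback.lift_snd]
  · intro x hx
    obtain ⟨K, _, t, p, rfl⟩ := exists_fieldPoint x
    rw [mem_eqLocus_iff] at hx
    -- Agreement at the field-valued point `t` says that `t` is the graph applied to its own first
    -- component.
    refine ⟨(t ≫ pullback.fst _ _) p, ?_⟩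
    rw [← Scheme.Hom.comp_apply]
    refine congrArg (fun u : Spec (.of K) ⟶ pullback B.str V.str => u p) ?_
    apply pullback.hom_ext
    · simp [graph, pullback.lift_fst]
    · simp [graph, pullback.lift_snd, hx]

/-- If the morphisms `s i : B ⟶ V` are nowhere equal to each other and `E` is the complement of
their graphs in `B × V`, then `[E] = [B] ([V] - N)`, where `N` is the number of these morphisms. -/
theorem cls_eq_of_compl_graphs {ι : Type} [Finite ι] (s : ι → (B.X ⟶ V.X))
    (hs : ∀ i, s i ≫ V.str = B.str)
    (hd : ∀ (K : Type u) [Field K] (t : Spec (.of K) ⟶ B.X) (i j : ι), i ≠ j → t ≫ s i ≠ t ≫ s j)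
    (a : E.X ⟶ B.X) (b : E.X ⟶ V.X) (h : a ≫ B.str = b ≫ V.str) (ha : a ≫ B.str = E.str)
    [IsImmersion (pullback.lift a b h)]
    (h1 : ∀ (K : Type u) [Field K] (t : Spec (.of K) ⟶ E.X) (i : ι), t ≫ a ≫ s i ≠ t ≫ b)
    (h2 : ∀ (K : Type u) [Field K] (t : Spec (.of K) ⟶ B.X) (v : Spec (.of K) ⟶ V.X),
      t ≫ B.str = v ≫ V.str → (∀ i, t ≫ s i ≠ v) → ∃ e : Spec (.of K) ⟶ E.X, e ≫ a = t ∧ e ≫ b = v) :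
    cls E = cls B * (cls V - (Nat.card ι : K0 F)) := by
  have := Fintype.ofFinite ι
  classical
  let q : pullback B.str V.str ⟶ Spec (.of F) := pullback.fst _ _ ≫ B.str
  -- The graphs are removed one at a time. Each is a copy of `B` that lies in what is left so far,
  -- so each removal subtracts `[B]`.
  have key (I : Finset ι) : cls B * (cls V - (I.card : K0 F)) =
      locCls q {x | ∀ i ∈ I, x ∉ Set.range (graph (s i) (hs i))} := by
    induction I using Finset.induction_on with
    | empty =>
      simp only [Finset.card_empty, Nat.cast_zero, sub_zero, cls_prod]
      rw [prod, cls_eq_locCls q (ofClosed q ⊤) (ofClosedι q ⊤) rfl, range_ofClosedι]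
      simp
    | insert j I hj ih =>
      have ho : IsOpen {x | ∀ i ∈ I, x ∉ Set.range (graph (s i) (hs i))} := by
        simp only [Set.ofPred_forall]
        exact I.finite_toSet.isOpen_biInter fun i _ =>
          (graph (s i) (hs i)).isClosedEmbedding.isClosed_range.isOpen_compl
      have e := locCls_eq_add q ho.isLocallyClosed
        (graph (s j) (hs j)).isClosedEmbedding.isClosed_range
      rw [← ih, Set.inter_eq_right.2,
        ← cls_eq_locCls q B (graph (s j) (hs j)) (by simp [q, graph, pullback.lift_fst_assoc])]
        at e
      · rw [Finset.card_insert_of_notMem hj]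
        have : {x | ∀ i ∈ insert j I, x ∉ Set.range (graph (s i) (hs i))} =
            {x | ∀ i ∈ I, x ∉ Set.range (graph (s i) (hs i))} \
              Set.range (graph (s j) (hs j)) := by
          ext x
          simp only [Finset.mem_insert, Set.mem_ofPred_eq, Set.mem_sdiff, forall_eq_or_imp]
          tauto
        rw [this]
        push_cast
        linear_combination e
      -- A common point of two graphs would be a field-valued point of `B` at which `s i` and `s j`
      -- coincide, against `hd`.
      · rintro x hx i hi hxi
        have hij : i ≠ j := fun h => hj (h ▸ hi)
        rw [range_graph] at hx hxi
        obtain ⟨K, _, t, p, rfl⟩ := exists_fieldPoint x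
        rw [mem_eqLocus_iff] at hx hxi
        refine hd K (t ≫ pullback.fst _ _) i j hij ?_
        rw [Category.assoc, Category.assoc, hx, hxi]
  -- It remains to see that the image of `E` is the complement of all the graphs: `h1` gives one
  -- inclusion, `h2` the other.
  rw [Nat.card_eq_fintype_card, ← Finset.card_univ, key,
    cls_eq_locCls q E (pullback.lift a b h) (by simp [q, ha, pullback.lift_fst_assoc])]
  congr 1
  ext x
  simp only [Finset.mem_univ, forall_const, Set.mem_ofPred_eq]
  constructor
  · rintro ⟨y, rfl⟩ i hi
    rw [range_graph] at hi
    obtain ⟨K, _, t, p, rfl⟩ := exists_fieldPoint y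
    rw [← Scheme.Hom.comp_apply, mem_eqLocus_iff] at hi
    refine h1 K t i ?_
    simpa [pullback.lift_fst_assoc, pullback.lift_snd] using hi
  · intro hx
    obtain ⟨K, _, t, p, rfl⟩ := exists_fieldPoint x
    obtain ⟨e, he, he'⟩ := h2 K (t ≫ pullback.fst _ _) (t ≫ pullback.snd _ _)
      (by simp [pullback.condition]) fun i hi => hx i (by
        rw [range_graph, mem_eqLocus_iff]
        simpa using hi)
    refine ⟨e p, ?_⟩
    rw [← Scheme.Hom.comp_apply]
    refine congrArg (fun u : Spec (.of K) ⟶ pullback B.str V.str => u p) ?_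
    apply pullback.hom_ext
    · simp [he, pullback.lift_fst]
    · simp [he', pullback.lift_snd]

end Graphs

end Variety

/-- A morphism from a reduced scheme factors through an immersion if its range does. -/
theorem exists_lift_of_range_subset {T X Y : Scheme.{u}} [IsReduced T] (t : T ⟶ X) (j : Y ⟶ X)
    [IsImmersion j] (h : Set.range t ⊆ Set.range j) : ∃ e : T ⟶ Y, e ≫ j = t := by
  have := surjective_pullback_fst_of_range_subset t j h
  have := isIso_of_isImmersion_of_surjective (pullback.fst t j)
  exact ⟨inv (pullback.fst t j) ≫ pullback.snd t j, by simp [← pullback.condition]⟩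

theorem exists_fieldPoint_lift {K : Type u} [Field K] {X Y : Scheme.{u}} (t : Spec (.of K) ⟶ X)
    (j : Y ⟶ X) [IsImmersion j] (p : Spec (.of K)) (h : t p ∈ Set.range j) :
    ∃ e : Spec (.of K) ⟶ Y, e ≫ j = t := by
  refine exists_lift_of_range_subset t j ?_
  rintro _ ⟨q, rfl⟩
  rwa [show q = p from Subsingleton.elim (α := PrimeSpectrum K) _ _]

namespace Variety

variable {F : Type u} [Field F]

/-! ### The class of a configuration space -/

section Conf

variable (V : Variety F)

/-- The inclusion of the configuration space into the power. -/
def confι (m : ℕ) : (conf m V).X ⟶ (V.pow m).X := openSubι (V.pow m) _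

instance (m : ℕ) : IsOpenImmersion (V.confι m) :=
  inferInstanceAs (IsOpenImmersion (openSubι (V.pow m) _))

theorem confι_str (m : ℕ) : V.confι m ≫ (V.pow m).str = (conf m V).str := rfl

theorem range_confι (m : ℕ) :
    Set.range (V.confι m) = {x | ∀ i j, i ≠ j → x ∉ V.bigDiagonal m i j} :=
  range_openSubι (V.pow m) _

theorem mem_range_confι {m : ℕ} {K : Type u} [Field K] (t : Spec (.of K) ⟶ (V.pow m).X)
    (p : Spec (.of K)) :
    t p ∈ Set.range (V.confι m) ↔ ∀ i j, i ≠ j → t ≫ V.coord m i ≠ t ≫ V.coord m j := by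
  rw [range_confι]
  change (∀ i j, i ≠ j → t p ∉ V.bigDiagonal m i j) ↔ _
  refine forall_congr' fun i => forall_congr' fun j => imp_congr_right fun _ => not_congr ?_
  exact mem_eqLocus_iff (str := V.str) t (V.coord m i) (V.coord m j) _ p

theorem comp_confι_coord_ne {m : ℕ} {K : Type u} [Field K] (t : Spec (.of K) ⟶ (conf m V).X)
    {i j : Fin m} (h : i ≠ j) :
    t ≫ V.confι m ≫ V.coord m i ≠ t ≫ V.confι m ≫ V.coord m j := by
  have := (V.mem_range_confι (t ≫ V.confι m) (⊥ : PrimeSpectrum K)).1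
    ⟨t (⊥ : PrimeSpectrum K), (Scheme.Hom.comp_apply _ _ _).symm⟩ i j h
  simpa using this

/-- The closed immersion of the product of varieties into the fibre product. -/
def prodι (W : Variety F) : (V.prod W).X ⟶ pullback V.str W.str :=
  ofClosedι (pullback.fst V.str W.str ≫ V.str) ⊤

instance (W : Variety F) : IsClosedImmersion (V.prodι W) :=
  inferInstanceAs (IsClosedImmersion (ofClosedι _ _))

theorem range_prodι (W : Variety F) : Set.range (V.prodι W) = Set.univ :=
  range_ofClosedι _ _

/-- Forgetting the last coordinate. -/
def powFst (m : ℕ) : (V.pow (m + 1)).X ⟶ (V.pow m).X := (V.pow m).fst V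

/-- The last coordinate. -/
def powSnd (m : ℕ) : (V.pow (m + 1)).X ⟶ V.X := (V.pow m).snd V

/-- The closed immersion of a power into a fibre product. -/
def powι (m : ℕ) : (V.pow (m + 1)).X ⟶ pullback (V.pow m).str V.str := (V.pow m).prodι V

instance (m : ℕ) : IsClosedImmersion (V.powι m) :=
  inferInstanceAs (IsClosedImmersion ((V.pow m).prodι V))

theorem range_powι (m : ℕ) : Set.range (V.powι m) = Set.univ := (V.pow m).range_prodι V

theorem powι_fst (m : ℕ) : V.powι m ≫ pullback.fst _ _ = V.powFst m := rfl

theorem powι_snd (m : ℕ) : V.powι m ≫ pullback.snd _ _ = V.powSnd m := rfl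

theorem powFst_str (m : ℕ) : V.powFst m ≫ (V.pow m).str = (V.pow (m + 1)).str :=
  fst_str (V.pow m) V

theorem powSnd_str (m : ℕ) : V.powSnd m ≫ V.str = (V.pow (m + 1)).str :=
  snd_str (V.pow m) V

theorem powFst_coord (m : ℕ) (i : Fin m) :
    V.powFst m ≫ V.coord m i = V.coord (m + 1) i.castSucc := (V.coord_castSucc m i).symm

theorem powSnd_eq (m : ℕ) : V.powSnd m = V.coord (m + 1) (Fin.last m) := (V.coord_last m).symm

theorem exists_conf_forget (m : ℕ) : ∃ a : (conf (m + 1) V).X ⟶ (conf m V).X,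
    a ≫ V.confι m = V.confι (m + 1) ≫ V.powFst m := by
  have : IsReduced (conf (m + 1) V).X := (conf (m + 1) V).isReduced
  refine exists_lift_of_range_subset _ _ ?_
  rintro _ ⟨x, rfl⟩
  obtain ⟨K, _, t, p, rfl⟩ := exists_fieldPoint x
  rw [← Scheme.Hom.comp_apply, mem_range_confι]
  intro i j hij
  rw [Category.assoc, Category.assoc, Category.assoc, Category.assoc, powFst_coord, powFst_coord]
  exact V.comp_confι_coord_ne t fun h => hij (Fin.castSucc_injective _ h)

/-- Over `conf m V` the new point avoids the `m` sections given by the old coordinates, and these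
are nowhere equal by the definition of a configuration space. -/
theorem cls_conf_succ (m : ℕ) : cls (conf (m + 1) V) = cls (conf m V) * (cls V - (m : K0 F)) := by
  obtain ⟨a, ha⟩ := V.exists_conf_forget m
  let b : (conf (m + 1) V).X ⟶ V.X := V.confι (m + 1) ≫ V.powSnd m
  have ha' : a ≫ (conf m V).str = (conf (m + 1) V).str := by
    rw [← confι_str, reassoc_of% ha, powFst_str]
    rfl
  have h : a ≫ (conf m V).str = b ≫ V.str := by
    rw [ha', show b = V.confι (m + 1) ≫ V.powSnd m from rfl, Category.assoc, powSnd_str]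
    rfl
  -- After composition with `g` the map becomes an open immersion followed by the closed immersion
  -- `powι`, and the immersion property can be cancelled from the right.
  let g : pullback (conf m V).str V.str ⟶ pullback (V.pow m).str V.str :=
    pullback.map _ _ _ _ (V.confι m) (𝟙 _) (𝟙 _) (by simp [confι_str]) (by simp)
  have hg : pullback.lift a b h ≫ g = V.confι (m + 1) ≫ V.powι m := by
    apply pullback.hom_ext
    · simp [g, pullback.lift_fst, pullback.lift_fst_assoc, ha, powι_fst]
    · simp [g, pullback.lift_snd, b, powι_snd]
  have hi : IsImmersion (pullback.lift a b h ≫ g) := by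
    rw [hg]
    exact IsImmersion.comp (V.confι (m + 1)) (V.powι m)
  have : IsImmersion (pullback.lift a b h) := IsImmersion.of_comp _ g
  have := cls_eq_of_compl_graphs (B := conf m V) (V := V) (E := conf (m + 1) V)
    (fun i : Fin m => V.confι m ≫ V.coord m i)
    (fun i => by rw [Category.assoc, coord_str, confι_str])
    (fun K _ t i j hij => V.comp_confι_coord_ne t hij) a b h ha' ?_ ?_
  · simpa using this
  · intro K _ t i
    rw [reassoc_of% ha]
    simp only [b]
    rw [powFst_coord, powSnd_eq]
    exact V.comp_confι_coord_ne t (Fin.castSucc_lt_last i).ne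
  · intro K _ t v htv hn
    let p : Spec (.of K) := (⊥ : PrimeSpectrum K)
    -- The power carries the reduced structure of the fibre product; it has the same points, so the
    -- pair of field-valued points lifts to it.
    obtain ⟨w, hw⟩ := exists_fieldPoint_lift
      (pullback.lift (t ≫ V.confι m) v (by simpa [confι_str] using htv)) (V.powι m) p
      (by rw [range_powι]; trivial)
    have hw1 : w ≫ V.powFst m = t ≫ V.confι m := by
      rw [← powι_fst, reassoc_of% hw, pullback.lift_fst]
    have hw2 : w ≫ V.powSnd m = v := by
      rw [← powι_snd, reassoc_of% hw, pullback.lift_snd]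
    have hc (i : Fin m) : w ≫ V.coord (m + 1) i.castSucc = t ≫ V.confι m ≫ V.coord m i := by
      rw [← powFst_coord, reassoc_of% hw1]
    have hl : w ≫ V.coord (m + 1) (Fin.last m) = v := by
      rw [← powSnd_eq, hw2]
    obtain ⟨e, he⟩ := exists_fieldPoint_lift (X := (V.pow (m + 1)).X) w (V.confι (m + 1)) p (by
      rw [mem_range_confι]
      intro i j hij
      induction i using Fin.lastCases with
      | last =>
        induction j using Fin.lastCases with
        | last => exact absurd rfl hij
        | cast j =>
          rw [hl, hc]
          exact (hn j).symm
      | cast i =>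
        induction j using Fin.lastCases with
        | last =>
          rw [hl, hc]
          exact hn i
        | cast j =>
          rw [hc, hc]
          exact V.comp_confι_coord_ne t fun h => hij (h ▸ rfl))
    refine ⟨e, ?_, ?_⟩
    · rw [← cancel_mono (V.confι m), Category.assoc, ha, reassoc_of% he, hw1]
    · simp only [b]
      rw [reassoc_of% he, hw2]

theorem cls_conf (m : ℕ) : cls (conf m V) = ∏ j ∈ Finset.range m, (cls V - (j : K0 F)) := by
  induction m with
  | zero =>
    rw [Finset.prod_range_zero, ← cls_point]
    refine (cls_eq_locCls (V.pow 0).str (conf 0 V) (V.confι 0) rfl).trans ?_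
    change _ = cls (V.pow 0)
    rw [← locCls_self]
    congr 1
    refine (V.range_confι 0).trans (Set.eq_univ_of_forall fun x => ?_)
    exact fun i => i.elim0
  | succ m ih => rw [cls_conf_succ, ih, Finset.prod_range_succ]

end Conf

/-! ### Affine space without finitely many rational points -/

section AffineMinus

/-- The rational point of affine space given by a vector. -/
def ratPointHom {d : ℕ} (a : Fin d → F) : (point F).X ⟶ (affineSpace F d).X :=
  Spec.map (CommRingCat.ofHom (MvPolynomial.eval a))

instance {d : ℕ} (a : Fin d → F) : IsClosedImmersion (ratPointHom a) :=
  IsClosedImmersion.spec_of_surjective (R := .of (MvPolynomial (Fin d) F)) (S := .of F) _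
    fun c => ⟨MvPolynomial.C c, by simp⟩

theorem ratPointHom_str {d : ℕ} (a : Fin d → F) :
    ratPointHom a ≫ (affineSpace F d).str = (point F).str := by
  refine (Spec.map_comp _ _).symm.trans ?_
  rw [← CommRingCat.ofHom_comp, show (MvPolynomial.eval a).comp
    (algebraMap F (MvPolynomial (Fin d) F)) = RingHom.id F by ext; simp]
  exact Spec.map_id _

theorem range_ratPointHom {d : ℕ} (a : Fin d → F) : Set.range (ratPointHom a) = {ratPoint a} := by
  have key (x : PrimeSpectrum F) : PrimeSpectrum.comap (MvPolynomial.eval a) x = ratPoint a := by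
    rw [Subsingleton.elim x ⊥]
    rfl
  refine Set.Subset.antisymm ?_ ?_
  · rintro _ ⟨x, rfl⟩
    exact key x
  · rintro _ rfl
    exact ⟨(⊥ : PrimeSpectrum F), key _⟩

theorem ratPoint_injective {d : ℕ} : Function.Injective (ratPoint (F := F) (d := d)) := by
  intro a b h
  ext i
  have h' : RingHom.ker (MvPolynomial.eval a) = RingHom.ker (MvPolynomial.eval b) :=
    congrArg PrimeSpectrum.asIdeal h
  have : (MvPolynomial.X i - MvPolynomial.C (a i) : MvPolynomial (Fin d) F) ∈
      RingHom.ker (MvPolynomial.eval b) := by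
    rw [← h']
    simp [RingHom.mem_ker]
  have h0 : b i - a i = 0 := by simpa [RingHom.mem_ker] using this
  exact (sub_eq_zero.1 h0).symm

/-- Each rational point is a copy of `Spec F`, of class 1, and distinct vectors give distinct
points. -/
theorem cls_affineMinus {d : ℕ} (S : Finset (Fin d → F)) :
    cls (affineMinus S) = cls (affineSpace F d) - (S.card : K0 F) := by
  classical
  let f := (affineSpace F d).str
  have key (S : Finset (Fin d → F)) : cls (affineSpace F d) - (S.card : K0 F) =
      locCls f {x | ∀ a ∈ S, x ≠ ratPoint a} := by
    induction S using Finset.induction_on with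
    | empty =>
      rw [← locCls_self]
      simp [f]
    | insert a S ha ih =>
      have ho : IsOpen {x | ∀ a ∈ S, x ≠ ratPoint a} := by
        simp only [Set.ofPred_forall]
        exact S.finite_toSet.isOpen_biInter fun a _ => (isClosed_ratPoint a).isOpen_compl
      have e := locCls_eq_add f ho.isLocallyClosed (isClosed_ratPoint a)
      rw [← ih, Set.inter_eq_right.2, ← range_ratPointHom a,
        ← cls_eq_locCls f (point F) (ratPointHom a) (ratPointHom_str a), range_ratPointHom,
        cls_point] at e
      · rw [Finset.card_insert_of_notMem ha]
        have : {x | ∀ b ∈ insert a S, x ≠ ratPoint b} =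
            {x | ∀ b ∈ S, x ≠ ratPoint b} \ {ratPoint a} := by
          ext x
          simp only [Finset.mem_insert, Set.mem_ofPred_eq, Set.mem_sdiff, forall_eq_or_imp,
            Set.mem_singleton_iff]
          tauto
        rw [this]
        push_cast
        linear_combination e
      · rintro _ rfl b hb h
        exact ha (ratPoint_injective h ▸ hb)
  rw [key, affineMinus, cls_eq_locCls f _ (openSubι (affineSpace F d) _) rfl, range_openSubι]
  rfl

end AffineMinus

/-! ### Affine spaces with arbitrary finite coordinate sets -/

section Affine

/-- Affine space with coordinates indexed by a finite type. -/
def affVar (F : Type u) [Field F] (σ : Type) [Finite σ] : Variety F where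
  X := Spec (.of (MvPolynomial σ F))
  str := Spec.map (CommRingCat.ofHom (algebraMap F (MvPolynomial σ F)))
  locallyOfFiniteType := by
    rw [HasRingHomProperty.Spec_iff (P := @LocallyOfFiniteType)]
    exact RingHom.finiteType_algebraMap.2 inferInstance

variable {σ τ ρ : Type}

section

variable [Finite σ] [Finite τ]

/-- The point of affine space given by a homomorphism to a field. -/
def homPt {K : Type u} [Field K] (φ : MvPolynomial σ F →+* K) : (affVar F σ).X :=
  (⟨RingHom.ker φ, RingHom.ker_isPrime _⟩ : PrimeSpectrum (MvPolynomial σ F))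

/-- The field-valued point of affine space given by a homomorphism to a field. -/
def homSpec {R : Type u} [CommRing R] (φ : MvPolynomial σ F →+* R) :
    Spec (.of R) ⟶ (affVar F σ).X :=
  Spec.map (CommRingCat.ofHom φ)

theorem homSpec_apply {K : Type u} [Field K] (φ : MvPolynomial σ F →+* K) (p : Spec (.of K)) :
    homSpec φ p = homPt φ := by
  change PrimeSpectrum.comap φ p = _
  rw [Subsingleton.elim (α := PrimeSpectrum K) p ⊥]
  rfl

theorem homSpec_surjective {R : Type u} [CommRing R] (t : Spec (.of R) ⟶ (affVar F σ).X) :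
    ∃ φ : MvPolynomial σ F →+* R, homSpec φ = t :=
  ⟨(Spec.preimage (R := .of (MvPolynomial σ F)) t).hom, Spec.map_preimage _⟩

theorem homSpec_injective {R : Type u} [CommRing R] :
    Function.Injective (homSpec (F := F) (σ := σ) (R := R)) := by
  intro φ ψ h
  exact congrArg CommRingCat.Hom.hom (Spec.map_injective h)

theorem homSpec_str {R : Type u} [CommRing R] (φ : MvPolynomial σ F →+* R) :
    homSpec φ ≫ (affVar F σ).str = Spec.map (CommRingCat.ofHom (φ.comp MvPolynomial.C)) :=
  (Spec.map_comp _ _).symm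

/-- The morphism of affine spaces given by polynomials. -/
def polyMap (θ : MvPolynomial σ F →ₐ[F] MvPolynomial τ F) :
    (affVar F τ).X ⟶ (affVar F σ).X :=
  homSpec (θ : MvPolynomial σ F →+* MvPolynomial τ F)

theorem polyMap_str (θ : MvPolynomial σ F →ₐ[F] MvPolynomial τ F) :
    polyMap θ ≫ (affVar F σ).str = (affVar F τ).str := by
  refine (homSpec_str _).trans ?_
  exact congrArg (fun g => Spec.map (CommRingCat.ofHom g)) θ.comp_algebraMap

theorem homSpec_polyMap {R : Type u} [CommRing R] (θ : MvPolynomial σ F →ₐ[F] MvPolynomial τ F)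
    (φ : MvPolynomial τ F →+* R) :
    homSpec φ ≫ polyMap θ = homSpec (φ.comp (θ : MvPolynomial σ F →+* MvPolynomial τ F)) :=
  (Spec.map_comp _ _).symm

end

section Sum

variable {inl : σ → ρ} {inr : τ → ρ} (hb : Function.Bijective (Sum.elim inl inr))

include hb in
-- This is the universal property of the polynomial ring as a coproduct of `F`-algebras. The
-- splitting of the index set is recorded by a bijection, as the sets in use are subtypes and not
-- literally sums.
theorem exists_ringHom_of_bijective {R : Type u} [CommRing R] (φ : MvPolynomial σ F →+* R)
    (ψ : MvPolynomial τ F →+* R) (h : φ.comp MvPolynomial.C = ψ.comp MvPolynomial.C) :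
    ∃ χ : MvPolynomial ρ F →+* R,
      χ.comp (MvPolynomial.rename (R := F) inl : MvPolynomial σ F →+* MvPolynomial ρ F) = φ ∧
      χ.comp (MvPolynomial.rename (R := F) inr : MvPolynomial τ F →+* MvPolynomial ρ F) = ψ := by
  let e := Equiv.ofBijective _ hb
  have e1 (i : σ) : e.symm (inl i) = Sum.inl i := e.symm_apply_apply (Sum.inl i)
  have e2 (i : τ) : e.symm (inr i) = Sum.inr i := e.symm_apply_apply (Sum.inr i)
  refine ⟨MvPolynomial.eval₂Hom (φ.comp MvPolynomial.C) fun k => Sum.elim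
    (fun i => φ (MvPolynomial.X i)) (fun i => ψ (MvPolynomial.X i)) (e.symm k), ?_, ?_⟩
  · refine MvPolynomial.ringHom_ext (fun r => ?_) fun i => ?_
    · simp
    · simp [e1]
  · refine MvPolynomial.ringHom_ext (fun r => ?_) fun i => ?_
    · simpa using congrArg (fun g : F →+* R => g r) h
    · simp [e2]

include hb in
theorem ringHom_ext_of_bijective {R : Type u} [CommRing R] (χ χ' : MvPolynomial ρ F →+* R)
    (h1 : χ.comp (MvPolynomial.rename (R := F) inl : MvPolynomial σ F →+* MvPolynomial ρ F) =
      χ'.comp (MvPolynomial.rename (R := F) inl : MvPolynomial σ F →+* MvPolynomial ρ F))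
    (h2 : χ.comp (MvPolynomial.rename (R := F) inr : MvPolynomial τ F →+* MvPolynomial ρ F) =
      χ'.comp (MvPolynomial.rename (R := F) inr : MvPolynomial τ F →+* MvPolynomial ρ F)) :
    χ = χ' := by
  refine MvPolynomial.ringHom_ext (fun r => ?_) fun k => ?_
  · simpa using congrArg (fun g : MvPolynomial σ F →+* R => g (MvPolynomial.C r)) h1
  · obtain ⟨i | i, rfl⟩ := hb.2 k
    · simpa using congrArg (fun g : MvPolynomial σ F →+* R => g (MvPolynomial.X i)) h1
    · simpa using congrArg (fun g : MvPolynomial τ F →+* R => g (MvPolynomial.X i)) h2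

include hb in
theorem isPushout_of_bijective : IsPushout
    (CommRingCat.ofHom (algebraMap F (MvPolynomial σ F)))
    (CommRingCat.ofHom (algebraMap F (MvPolynomial τ F)))
    (CommRingCat.ofHom (MvPolynomial.rename (R := F) inl : MvPolynomial σ F →+* MvPolynomial ρ F))
    (CommRingCat.ofHom
      (MvPolynomial.rename (R := F) inr : MvPolynomial τ F →+* MvPolynomial ρ F)) := by
  refine ⟨⟨?_⟩, ⟨?_⟩⟩
  · ext r
    simp
  · have key (s : PushoutCocone (CommRingCat.ofHom (algebraMap F (MvPolynomial σ F)))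
        (CommRingCat.ofHom (algebraMap F (MvPolynomial τ F)))) :=
      exists_ringHom_of_bijective hb s.inl.hom s.inr.hom
        (congrArg CommRingCat.Hom.hom s.condition)
    choose d hd using key
    refine PushoutCocone.IsColimit.mk _ (fun s => CommRingCat.ofHom (d s)) ?_ ?_ ?_
    · exact fun s => CommRingCat.hom_ext (hd s).1
    · exact fun s => CommRingCat.hom_ext (hd s).2
    · intro s m h1 h2
      refine CommRingCat.hom_ext (ringHom_ext_of_bijective hb _ _ ?_ ?_)
      · exact (congrArg CommRingCat.Hom.hom h1).trans (hd s).1.symm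
      · exact (congrArg CommRingCat.Hom.hom h2).trans (hd s).2.symm

section

variable [Finite σ] [Finite τ] [Finite ρ]

include hb in
theorem isPullback_polyMap : IsPullback (polyMap (F := F) (MvPolynomial.rename inl))
    (polyMap (MvPolynomial.rename inr)) (affVar F σ).str (affVar F τ).str :=
  isPullback_SpecMap_of_isPushout _ _ _ _ (isPushout_of_bijective hb)

include hb in
/-- The class of an open subset `W` of affine space `𝔸^(σ ⊕ τ)` that consists of the pairs `(x, y)`
with `x ∈ U` such that `y` differs from the values at `x` of some polynomial maps `s i`, where the
maps `s i` are nowhere equal to each other on `U`. -/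
theorem cls_openSub_affVar {ι : Type} [Finite ι] (s : ι → τ → MvPolynomial σ F)
    (U : (affVar F σ).X.Opens) (W : (affVar F ρ).X.Opens)
    (hd : ∀ (K : Type u) [Field K] (φ : MvPolynomial σ F →+* K), homPt φ ∈ U →
      ∀ i j, i ≠ j → ∃ k, φ (s i k) ≠ φ (s j k))
    (hW : ∀ (K : Type u) [Field K] (φ : MvPolynomial ρ F →+* K), homPt φ ∈ W ↔
      homPt (φ.comp (MvPolynomial.rename (R := F) inl : MvPolynomial σ F →+* MvPolynomial ρ F)) ∈ U
        ∧ ∀ i, ∃ k, φ (MvPolynomial.rename inl (s i k)) ≠ φ (MvPolynomial.X (inr k))) :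
    cls ((affVar F ρ).openSub W) =
      cls ((affVar F σ).openSub U) * (cls (affVar F τ) - (Nat.card ι : K0 F)) := by
  -- `hpt` and `hlift` identify the field-valued points of an open subvariety of affine space with
  -- the homomorphisms whose kernel lies in the open set.
  have hpt {K : Type u} [Field K] {ω : Type} [Finite ω] (O : (affVar F ω).X.Opens)
      (t : Spec (.of K) ⟶ ((affVar F ω).openSub O).X) :
      ∃ φ : MvPolynomial ω F →+* K, t ≫ openSubι _ O = homSpec φ ∧ homPt φ ∈ O := by
    obtain ⟨φ, hφ⟩ := homSpec_surjective (t ≫ openSubι _ O)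
    refine ⟨φ, hφ.symm, ?_⟩
    rw [← homSpec_apply φ (⊥ : PrimeSpectrum K), hφ]
    exact (range_openSubι (affVar F ω) O).subset ⟨t (⊥ : PrimeSpectrum K), rfl⟩
  have hlift {K : Type u} [Field K] {ω : Type} [Finite ω] (O : (affVar F ω).X.Opens)
      (φ : MvPolynomial ω F →+* K) (h : homPt φ ∈ O) :
      ∃ t : Spec (.of K) ⟶ ((affVar F ω).openSub O).X, t ≫ openSubι _ O = homSpec φ := by
    let p : Spec (.of K) := (⊥ : PrimeSpectrum K)
    refine exists_fieldPoint_lift _ _ p ?_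
    rw [homSpec_apply, range_openSubι]
    exact h
  have hcomp {K : Type u} [Field K] (φ : MvPolynomial σ F →+* K) (i : ι)
      (ψ : MvPolynomial τ F →+* K) (h : φ.comp MvPolynomial.C = ψ.comp MvPolynomial.C) :
      homSpec φ ≫ polyMap (MvPolynomial.aeval (s i)) = homSpec ψ ↔
        ∀ k, φ (s i k) = ψ (MvPolynomial.X k) := by
    rw [homSpec_polyMap, homSpec_injective.eq_iff]
    constructor
    · intro e k
      simpa using congrArg (fun g : MvPolynomial τ F →+* K => g (MvPolynomial.X k)) e
    · intro e
      refine MvPolynomial.ringHom_ext (fun r => ?_) fun k => ?_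
      · simpa using congrArg (fun g : F →+* K => g r) h
      · simpa using e k
  let B := (affVar F σ).openSub U
  let E := (affVar F ρ).openSub W
  let jB : B.X ⟶ (affVar F σ).X := openSubι _ U
  let jE : E.X ⟶ (affVar F ρ).X := openSubι _ W
  have hB : jB ≫ (affVar F σ).str = B.str := rfl
  have hE : jE ≫ (affVar F ρ).str = E.str := rfl
  have : IsOpenImmersion jB := inferInstanceAs (IsOpenImmersion (openSubι _ U))
  have : IsOpenImmersion jE := inferInstanceAs (IsOpenImmersion (openSubι _ W))
  have hr : IsReduced E.X := E.isReduced
  obtain ⟨a, ha⟩ : ∃ a : E.X ⟶ B.X, a ≫ jB = jE ≫ polyMap (MvPolynomial.rename inl) := by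
    refine exists_lift_of_range_subset _ _ ?_
    rintro _ ⟨x, rfl⟩
    obtain ⟨K, _, t, p, rfl⟩ := exists_fieldPoint x
    obtain ⟨φ, hφ, hφ'⟩ := hpt W t
    have : (jE ≫ polyMap (MvPolynomial.rename inl)) (t p) =
        homPt (φ.comp (MvPolynomial.rename (R := F) inl :
          MvPolynomial σ F →+* MvPolynomial ρ F)) := by
      rw [← Scheme.Hom.comp_apply, reassoc_of% hφ, homSpec_polyMap, homSpec_apply]
    rw [this]
    exact (range_openSubι (affVar F σ) U).superset ((hW K φ).1 hφ').1
  let b : E.X ⟶ (affVar F τ).X := jE ≫ polyMap (MvPolynomial.rename inr)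
  have ha' : a ≫ B.str = E.str := by
    rw [← hB, reassoc_of% ha, polyMap_str, hE]
  have h : a ≫ B.str = b ≫ (affVar F τ).str := by
    rw [ha', Category.assoc, polyMap_str, hE]
  let g : pullback B.str (affVar F τ).str ⟶ pullback (affVar F σ).str (affVar F τ).str :=
    pullback.map _ _ _ _ jB (𝟙 _) (𝟙 _) (by simp [hB]) (by simp)
  -- Inside `𝔸^σ × 𝔸^τ ≅ 𝔸^ρ` the map `(a, b)` becomes the open immersion of `W`, so it is itself an
  -- immersion.
  have hg : pullback.lift a b h ≫ g = jE ≫ (isPullback_polyMap hb).isoPullback.hom := by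
    apply pullback.hom_ext
    · simp [g, pullback.lift_fst, pullback.lift_fst_assoc, ha]
    · simp [g, pullback.lift_snd, b]
  have hi : IsImmersion (pullback.lift a b h ≫ g) := by
    rw [hg]
    infer_instance
  have : IsImmersion (pullback.lift a b h) := IsImmersion.of_comp _ g
  refine cls_eq_of_compl_graphs (B := B) (V := affVar F τ) (E := E)
    (fun i => jB ≫ polyMap (MvPolynomial.aeval (s i)))
    (fun i => by rw [Category.assoc, polyMap_str, hB]) ?_ a b h ha' ?_ ?_
  · intro K _ t i j hij e
    obtain ⟨φ, hφ, hφ'⟩ := hpt U t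
    obtain ⟨k, hk⟩ := hd K φ hφ' i j hij
    simp only [jB] at e
    rw [reassoc_of% hφ, reassoc_of% hφ, homSpec_polyMap (MvPolynomial.aeval (s j)), hcomp] at e
    · exact hk (by simpa using e k)
    · ext r
      simp
  · intro K _ t i e
    obtain ⟨φ, hφ, hφ'⟩ := hpt W t
    obtain ⟨k, hk⟩ := ((hW K φ).1 hφ').2 i
    rw [reassoc_of% ha] at e
    simp only [b, jE] at e
    rw [reassoc_of% hφ, reassoc_of% hφ, reassoc_of% homSpec_polyMap (MvPolynomial.rename inl),
      homSpec_polyMap (MvPolynomial.rename inr), hcomp] at e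
    · exact hk (by simpa using e k)
    · ext r
      simp
  · intro K _ t v htv hn
    obtain ⟨φ, hφ, hφ'⟩ := hpt U t
    obtain ⟨ψ, rfl⟩ := homSpec_surjective v
    have hC : φ.comp MvPolynomial.C = ψ.comp MvPolynomial.C := by
      rw [← hB] at htv
      simp only [jB] at htv
      rw [reassoc_of% hφ, homSpec_str, homSpec_str] at htv
      exact congrArg CommRingCat.Hom.hom (Spec.map_injective htv)
    obtain ⟨χ, hχ1, hχ2⟩ := exists_ringHom_of_bijective hb φ ψ hC
    obtain ⟨e, he⟩ := hlift W χ ((hW K χ).2 ⟨hχ1 ▸ hφ', fun i => by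
      by_contra! hcon
      refine hn i ?_
      simp only [jB]
      rw [reassoc_of% hφ, hcomp _ _ _ hC]
      intro k
      rw [← hχ1, ← hχ2]
      simpa using hcon k⟩)
    refine ⟨e, ?_, ?_⟩
    · rw [← cancel_mono jB, Category.assoc, ha]
      simp only [jE, jB]
      rw [reassoc_of% he, homSpec_polyMap, hφ, hχ1]
    · simp only [b, jE]
      rw [reassoc_of% he, homSpec_polyMap, hχ2]

include hb in
-- The case of `cls_openSub_affVar` with no sections to avoid and with `U` and `W` the whole spaces.
theorem cls_affVar_of_bijective : cls (affVar F ρ) = cls (affVar F σ) * cls (affVar F τ) := by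
  have htop {ω : Type} [Finite ω] : cls ((affVar F ω).openSub ⊤) = cls (affVar F ω) := by
    rw [← locCls_self (affVar F ω),
      cls_eq_locCls (affVar F ω).str ((affVar F ω).openSub ⊤) (openSubι _ _) rfl, range_openSubι]
    rfl
  have := cls_openSub_affVar (F := F) hb (ι := Empty) (fun i => i.elim) ⊤ ⊤
    (fun K _ φ _ i => i.elim) (fun K _ φ => ⟨fun _ => ⟨trivial, fun i => i.elim⟩, fun _ => trivial⟩)
  simpa [htop] using this

end

end Sum

theorem cls_affVar_of_isEmpty [Finite σ] [IsEmpty σ] : cls (affVar F σ) = 1 := by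
  rw [← cls_point]
  refine cls_eq_of_iso (V := affVar F σ) (W := point F)
    (Scheme.Spec.mapIso (MvPolynomial.isEmptyRingEquiv F σ).symm.toCommRingCatIso.op) ?_
  refine (Category.comp_id _).trans ?_
  change Spec.map _ = Spec.map _
  congr 1

theorem cls_affVar_of_equiv [Finite σ] [Finite ρ] (e : σ ≃ ρ) :
    cls (affVar F ρ) = cls (affVar F σ) := by
  have hb : Function.Bijective (Sum.elim e (fun i : Empty => i.elim)) := by
    constructor
    · rintro (i | i) (j | j) h
      · exact congrArg _ (e.injective h)
      all_goals exact Empty.elim (by assumption)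
    · exact fun k => ⟨Sum.inl (e.symm k), e.apply_symm_apply k⟩
  rw [cls_affVar_of_bijective hb, cls_affVar_of_isEmpty (σ := Empty), mul_one]

theorem cls_affVar (σ : Type) [Finite σ] :
    cls (affVar F σ) = cls (affineSpace F 1) ^ Nat.card σ := by
  revert ‹Finite σ›
  -- The variety depends on a `Finite` instance, so the induction motive has to quantify over it.
  suffices h : ∀ σ : Type, Finite σ → ∀ h : Finite σ,
      cls (affVar F σ) = cls (affineSpace F 1) ^ Nat.card σ from fun h' => h σ h' h'
  intro σ h0
  refine Finite.induction_empty_option (P := fun σ => ∀ h : Finite σ,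
      cls (affVar F σ) = cls (affineSpace F 1) ^ Nat.card σ) ?_ ?_ ?_ σ
  · intro α β e h hβ
    have hα : Finite α := Finite.of_equiv β e.symm
    rw [cls_affVar_of_equiv e, h, Nat.card_congr e]
  · intro h
    have : IsEmpty PEmpty := inferInstance
    rw [cls_affVar_of_isEmpty, Nat.card_of_isEmpty, pow_zero]
  · intro α _ h ho
    have hb : Function.Bijective (Sum.elim (some : α → Option α) (fun _ : Unit => none)) := by
      constructor
      · rintro (i | i) (j | j) h <;> simp_all
      · rintro (_ | k)
        · exact ⟨Sum.inr (), rfl⟩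
        · exact ⟨Sum.inl k, rfl⟩
    have hα : Finite α := inferInstance
    rw [cls_affVar_of_bijective hb, h hα,
      cls_affVar_of_equiv (σ := Fin 1) (ρ := Unit) (Equiv.ofUnique _ _), Finite.card_option,
      pow_succ]
    rfl

theorem cls_affineSpace (d : ℕ) : cls (affineSpace F d) = cls (affineSpace F 1) ^ d := by
  -- `affVar F (Fin d)` unfolds to `affineSpace F d`.
  have := cls_affVar (F := F) (Fin d)
  rwa [Nat.card_fin] at this

end Affine

/-! ### Echelon cells with distinct nonzero columns, built column by column -/

section Cell

variable {r : ℕ} (I : Fin r → ℕ)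

/-- The positions of the free entries, in the first `m` columns, of a matrix in reduced row echelon
form with pivot columns `I`. -/
abbrev FreeIdx (m : ℕ) : Type :=
  {p : Fin r × ℕ // p.2 < m ∧ I p.1 < p.2 ∧ p.2 ∉ Set.range I}

instance (m : ℕ) : Finite (FreeIdx I m) :=
  Finite.of_injective (fun p : FreeIdx I m => (p.1.1, (⟨p.1.2, p.2.1⟩ : Fin m))) fun p q h => by
    simp only [Prod.mk.injEq, Fin.mk.injEq] at h
    exact Subtype.ext (Prod.ext h.1 h.2)

open Classical in
/-- The entries of the generic matrix in reduced row echelon form with pivot columns `I`. -/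
def echelonEntry (F : Type u) [Field F] (m : ℕ) (a : Fin r) (j : ℕ) :
    MvPolynomial (FreeIdx I m) F :=
  if I a = j then 1 else
    -- Beyond the first `m` columns the entries off the pivots default to `0`; only columns below
    -- `m` enter `echelonOpen`.
    if h : j < m ∧ I a < j ∧ j ∉ Set.range I then MvPolynomial.X ⟨(a, j), h⟩ else 0

/-- The matrices in reduced row echelon form with pivot columns `I` whose first `m` columns are
distinct and nonzero. -/
def echelonOpen (F : Type u) [Field F] (m : ℕ) : (affVar F (FreeIdx I m)).X.Opens where
  carrier := {x : PrimeSpectrum (MvPolynomial (FreeIdx I m) F) |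
    (∀ j < m, ∃ a, echelonEntry I F m a j ∉ x.asIdeal) ∧
    ∀ i < m, ∀ j < m, i ≠ j →
      ∃ a, echelonEntry I F m a i - echelonEntry I F m a j ∉ x.asIdeal}
  is_open' := by
    have : IsOpen {x : PrimeSpectrum (MvPolynomial (FreeIdx I m) F) |
        (∀ j < m, ∃ a, echelonEntry I F m a j ∉ x.asIdeal) ∧ ∀ i < m, ∀ j < m, i ≠ j →
          ∃ a, echelonEntry I F m a i - echelonEntry I F m a j ∉ x.asIdeal} := by
      simp only [Set.ofPred_and, Set.ofPred_forall, Set.ofPred_exists]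
      refine IsOpen.inter
        ((Set.finite_lt_nat m).isOpen_biInter fun j _ => isOpen_iUnion fun a => ?_)
        ((Set.finite_lt_nat m).isOpen_biInter fun i _ => (Set.finite_lt_nat m).isOpen_biInter
          fun j _ => isOpen_iInter_of_finite fun _ => isOpen_iUnion fun a => ?_)
      · exact (PrimeSpectrum.basicOpen _).isOpen
      · exact (PrimeSpectrum.basicOpen _).isOpen
    exact this

variable {I}

theorem homPt_mem_echelonOpen {m : ℕ} {K : Type u} [Field K]
    (φ : MvPolynomial (FreeIdx I m) F →+* K) :
    homPt φ ∈ echelonOpen I F m ↔ (∀ j < m, ∃ a, φ (echelonEntry I F m a j) ≠ 0) ∧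
      ∀ i < m, ∀ j < m, i ≠ j →
        ∃ a, φ (echelonEntry I F m a i) ≠ φ (echelonEntry I F m a j) := by
  change ((∀ j < m, ∃ a, echelonEntry I F m a j ∉ RingHom.ker φ) ∧ ∀ i < m, ∀ j < m, i ≠ j →
      ∃ a, echelonEntry I F m a i - echelonEntry I F m a j ∉ RingHom.ker φ) ↔ _
  simp only [RingHom.mem_ker, map_sub, sub_eq_zero, ne_eq]

/-- The inclusion of the free positions in the first `m` columns. -/
def freeCast (m : ℕ) (p : FreeIdx I m) : FreeIdx I (m + 1) :=
  ⟨p.1, p.2.1.trans (Nat.lt_succ_self m), p.2.2⟩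

theorem rename_echelonEntry {m : ℕ} (a : Fin r) {j : ℕ} (hj : j < m) :
    MvPolynomial.rename (freeCast m) (echelonEntry I F m a j) = echelonEntry I F (m + 1) a j := by
  unfold echelonEntry
  by_cases h1 : I a = j
  · simp [h1]
  · by_cases h2 : I a < j ∧ j ∉ Set.range I
    · rw [if_neg h1, if_neg h1, dif_pos ⟨hj, h2⟩, dif_pos ⟨hj.trans (Nat.lt_succ_self m), h2⟩,
        MvPolynomial.rename_X]
      rfl
    · rw [if_neg h1, if_neg h1, dif_neg fun h => h2 h.2, dif_neg fun h => h2 h.2, map_zero]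

theorem echelonEntry_eq_zero {m : ℕ} {a : Fin r} {j : ℕ} (h : j < I a) :
    echelonEntry I F m a j = 0 := by
  unfold echelonEntry
  rw [if_neg h.ne', dif_neg fun h' => absurd h'.2.1 h.le.not_gt]

theorem echelonEntry_pivot {m : ℕ} {a : Fin r} {j : ℕ} (h : I a = j) :
    echelonEntry I F m a j = 1 := by
  unfold echelonEntry
  rw [if_pos h]

theorem echelonEntry_pivot_of_ne (hI : Function.Injective I) {m : ℕ} {a b : Fin r} (h : a ≠ b) :
    echelonEntry I F m a (I b) = 0 := by
  unfold echelonEntry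
  rw [if_neg (hI.ne h), dif_neg fun h' => h'.2.2 ⟨b, rfl⟩]

theorem echelonEntry_free {m : ℕ} (p : FreeIdx I m) :
    echelonEntry I F m p.1.1 p.1.2 = MvPolynomial.X p := by
  unfold echelonEntry
  rw [if_neg p.2.2.1.ne, dif_pos p.2]

variable (I) in
/-- The class of the locus of matrices in reduced row echelon form with pivot columns `I` whose
first `m` columns are distinct and nonzero. -/
def echelonCls (F : Type u) [Field F] (m : ℕ) : K0 F :=
  cls ((affVar F (FreeIdx I m)).openSub (echelonOpen I F m))

theorem echelonCls_zero : echelonCls I F 0 = 1 := by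
  have : IsEmpty (FreeIdx I 0) := ⟨fun p => absurd p.2.1 (Nat.not_lt_zero _)⟩
  have htop : echelonOpen I F 0 = ⊤ := by
    ext x
    change ((∀ j < 0, _) ∧ ∀ i < 0, _) ↔ True
    simp
  rw [echelonCls, htop, ← cls_affVar_of_isEmpty (F := F) (σ := FreeIdx I 0),
    ← locCls_self (affVar F (FreeIdx I 0)),
    cls_eq_locCls (affVar F (FreeIdx I 0)).str ((affVar F (FreeIdx I 0)).openSub ⊤)
      (openSubι _ _) rfl, range_openSubι]
  rfl

/-- A pivot column has no free entries, and no condition is added: in its row `b` it has the entry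
1, while all earlier columns have 0 there. -/
theorem echelonCls_succ_of_mem {m : ℕ} (hm : m ∈ Set.range I) :
    echelonCls I F (m + 1) = echelonCls I F m := by
  obtain ⟨b, hb⟩ := hm
  have hbij : Function.Bijective (Sum.elim (freeCast (I := I) m) (fun i : Empty => i.elim)) := by
    constructor
    · rintro (p | p) (q | q) h
      · exact congrArg _ (Subtype.ext (congrArg Subtype.val h :))
      all_goals exact Empty.elim (by assumption)
    · intro p
      have hp : p.1.2 ≠ m := fun h => p.2.2.2 ⟨b, hb.trans h.symm⟩
      exact ⟨Sum.inl ⟨p.1, by have := p.2.1; omega, p.2.2⟩, rfl⟩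
  have key := cls_openSub_affVar (F := F) hbij (ι := Empty) (fun i => i.elim) (echelonOpen I F m)
    (echelonOpen I F (m + 1)) (fun K _ φ _ i => i.elim) fun K _ φ => ?_
  · rw [cls_affVar_of_isEmpty (σ := Empty)] at key
    simpa [echelonCls] using key
  · rw [homPt_mem_echelonOpen, homPt_mem_echelonOpen]
    have hc (a : Fin r) (j : ℕ) (hj : j < m) :
        (φ.comp (MvPolynomial.rename (R := F) (freeCast (I := I) m) :
          MvPolynomial (FreeIdx I m) F →+* MvPolynomial (FreeIdx I (m + 1)) F))
            (echelonEntry I F m a j) = φ (echelonEntry I F (m + 1) a j) :=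
      congrArg φ (rename_echelonEntry a hj)
    have h1 : φ (echelonEntry I F (m + 1) b m) = 1 := by
      rw [echelonEntry_pivot hb, map_one]
    have h0 (j : ℕ) (hj : j < m) : φ (echelonEntry I F (m + 1) b j) = 0 := by
      rw [echelonEntry_eq_zero (by omega), map_zero]
    constructor
    · rintro ⟨h, h'⟩
      refine ⟨⟨fun j hj => ?_, fun i hi j hj hij => ?_⟩, fun i => i.elim⟩
      · obtain ⟨a, ha⟩ := h j (by omega)
        exact ⟨a, by rwa [hc a j hj]⟩
      · obtain ⟨a, ha⟩ := h' i (by omega) j (by omega) hij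
        exact ⟨a, by rwa [hc a j hj, hc a i hi]⟩
    · rintro ⟨⟨h, h'⟩, -⟩
      refine ⟨fun j hj => ?_, fun i hi j hj hij => ?_⟩
      · rcases Nat.lt_succ_iff_lt_or_eq.1 hj with hj | rfl
        · obtain ⟨a, ha⟩ := h j hj
          exact ⟨a, by rwa [hc a j hj] at ha⟩
        · exact ⟨b, by rw [h1]; exact one_ne_zero⟩
      · rcases Nat.lt_succ_iff_lt_or_eq.1 hi with hi | rfl <;>
          rcases Nat.lt_succ_iff_lt_or_eq.1 hj with hj | rfl
        · obtain ⟨a, ha⟩ := h' i hi j hj hij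
          exact ⟨a, by rwa [hc a j hj, hc a i hi] at ha⟩
        · exact ⟨b, by rw [h1, h0 i hi]; exact zero_ne_one⟩
        · exact ⟨b, by rw [h1, h0 j hj]; exact one_ne_zero⟩
        · exact absurd rfl hij

/-- The free entries of column `m` sit in the rows whose pivot is left of `m`. The earlier columns
are supported in these rows too, so they and the zero column are `m + 1` forbidden values, pairwise
different over the previous open set. -/
theorem echelonCls_succ_of_notMem {m : ℕ} (hm : m ∉ Set.range I) :
    echelonCls I F (m + 1) = echelonCls I F m *
      (cls (affineSpace F 1) ^ Nat.card {a // I a < m} - ((m + 1 : ℕ) : K0 F)) := by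
  let inr (a : {a // I a < m}) : FreeIdx I (m + 1) := ⟨(a.1, m), Nat.lt_succ_self m, a.2, hm⟩
  have hbij : Function.Bijective (Sum.elim (freeCast (I := I) m) inr) := by
    constructor
    · rintro (p | p) (q | q) h
      · exact congrArg _ (Subtype.ext (congrArg Subtype.val h :))
      · have h' : p.1.2 = m := congrArg (fun x : FreeIdx I (m + 1) => x.1.2) h
        exact absurd p.2.1 (by omega)
      · have h' : m = q.1.2 := congrArg (fun x : FreeIdx I (m + 1) => x.1.2) h
        exact absurd q.2.1 (by omega)
      · exact congrArg _ (Subtype.ext (congrArg (fun x : FreeIdx I (m + 1) => x.1.1) h))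
    · intro p
      by_cases hp : p.1.2 = m
      · exact ⟨Sum.inr ⟨p.1.1, p.2.2.1.trans_eq hp⟩, Subtype.ext (Prod.ext rfl hp.symm)⟩
      · exact ⟨Sum.inl ⟨p.1, by have := p.2.1; omega, p.2.2⟩, rfl⟩
  -- The forbidden values: `none` is the zero column, `some j` is column `j`.
  let s : Option (Fin m) → {a // I a < m} → MvPolynomial (FreeIdx I m) F :=
    fun o k => o.elim 0 fun j => echelonEntry I F m k j
  have hX (a : {a // I a < m}) :
      (MvPolynomial.X (inr a) : MvPolynomial (FreeIdx I (m + 1)) F) =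
        echelonEntry I F (m + 1) a m := (echelonEntry_free (inr a)).symm
  have key := cls_openSub_affVar (F := F) hbij s (echelonOpen I F m)
    (echelonOpen I F (m + 1)) ?_ ?_
  · rw [cls_affVar] at key
    simpa [echelonCls] using key
  · intro K _ φ hφ o o' hoo
    rw [homPt_mem_echelonOpen] at hφ
    have hk {a : Fin r} {j : Fin m} (h : φ (echelonEntry I F m a j) ≠ 0) : I a < m := by
      by_contra hcon
      exact h (by rw [echelonEntry_eq_zero (by omega), map_zero])
    rcases o with _ | i <;> rcases o' with _ | j
    · exact absurd rfl hoo
    · obtain ⟨a, ha⟩ := hφ.1 j j.2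
      exact ⟨⟨a, hk ha⟩, by simpa [s] using ha.symm⟩
    · obtain ⟨a, ha⟩ := hφ.1 i i.2
      exact ⟨⟨a, hk ha⟩, by simpa [s] using ha⟩
    · obtain ⟨a, ha⟩ := hφ.2 i i.2 j j.2 fun h => hoo (congrArg some (Fin.ext h))
      refine ⟨⟨a, ?_⟩, ha⟩
      by_contra hcon
      refine ha ?_
      rw [echelonEntry_eq_zero (by omega), echelonEntry_eq_zero (by omega)]
  · intro K _ φ
    rw [homPt_mem_echelonOpen, homPt_mem_echelonOpen]
    have hc (a : Fin r) (j : ℕ) (hj : j < m) :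
        (φ.comp (MvPolynomial.rename (R := F) (freeCast (I := I) m) :
          MvPolynomial (FreeIdx I m) F →+* MvPolynomial (FreeIdx I (m + 1)) F))
            (echelonEntry I F m a j) = φ (echelonEntry I F (m + 1) a j) :=
      congrArg φ (rename_echelonEntry a hj)
    -- As `m` is not a pivot, the remaining rows have their pivot beyond `m` and vanish up to column
    -- `m`; so only the free rows can distinguish columns.
    have hz (a : Fin r) (ha : ¬ I a < m) (j : ℕ) (hj : j ≤ m) :
        φ (echelonEntry I F (m + 1) a j) = 0 := by
      have : I a ≠ m := fun h => hm ⟨a, h⟩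
      rw [echelonEntry_eq_zero (by omega), map_zero]
    constructor
    · rintro ⟨h, h'⟩
      refine ⟨⟨fun j hj => ?_, fun i hi j hj hij => ?_⟩, ?_⟩
      · obtain ⟨a, ha⟩ := h j (by omega)
        exact ⟨a, by rwa [hc a j hj]⟩
      · obtain ⟨a, ha⟩ := h' i (by omega) j (by omega) hij
        exact ⟨a, by rwa [hc a j hj, hc a i hi]⟩
      · rintro (_ | j)
        · obtain ⟨a, ha⟩ := h m (by omega)
          have ham : I a < m := by
            by_contra hcon
            exact ha (hz a hcon m le_rfl)
          refine ⟨⟨a, ham⟩, ?_⟩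
          rw [hX]
          simpa [s] using ha.symm
        · obtain ⟨a, ha⟩ := h' j (by omega) m (by omega) (by omega)
          have ham : I a < m := by
            by_contra hcon
            exact ha (by rw [hz a hcon m le_rfl, hz a hcon j (by omega)])
          refine ⟨⟨a, ham⟩, ?_⟩
          rw [hX]
          simpa [s, rename_echelonEntry] using ha
    · rintro ⟨⟨h, h'⟩, hs⟩
      have hs0 : ∃ a, φ (echelonEntry I F (m + 1) a m) ≠ 0 := by
        obtain ⟨k, hk⟩ := hs none
        rw [hX] at hk
        exact ⟨k, by simpa [s] using hk.symm⟩
      have hs1 (j : ℕ) (hj : j < m) :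
          ∃ a, φ (echelonEntry I F (m + 1) a j) ≠ φ (echelonEntry I F (m + 1) a m) := by
        obtain ⟨k, hk⟩ := hs (some ⟨j, hj⟩)
        rw [hX] at hk
        exact ⟨k, by simpa [s, rename_echelonEntry, hj] using hk⟩
      refine ⟨fun j hj => ?_, fun i hi j hj hij => ?_⟩
      · rcases Nat.lt_succ_iff_lt_or_eq.1 hj with hj | rfl
        · obtain ⟨a, ha⟩ := h j hj
          exact ⟨a, by rwa [hc a j hj] at ha⟩
        · exact hs0
      · rcases Nat.lt_succ_iff_lt_or_eq.1 hi with hi | rfl <;>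
          rcases Nat.lt_succ_iff_lt_or_eq.1 hj with hj | rfl
        · obtain ⟨a, ha⟩ := h' i hi j hj hij
          exact ⟨a, by rwa [hc a j hj, hc a i hi] at ha⟩
        · exact hs1 i hi
        · obtain ⟨a, ha⟩ := hs1 j hj
          exact ⟨a, ha.symm⟩
        · exact absurd rfl hij

open Classical in
theorem echelonCls_eq_prod (m : ℕ) : echelonCls I F m = ∏ c ∈ Finset.range m with c ∉ Set.range I,
    (cls (affineSpace F 1) ^ Nat.card {a // I a < c} - ((c + 1 : ℕ) : K0 F)) := by
  induction m with
  | zero => simp [echelonCls_zero]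
  | succ m ih =>
    rw [Finset.range_add_one, Finset.filter_insert]
    by_cases hm : m ∈ Set.range I
    · rw [if_neg (not_not.2 hm), echelonCls_succ_of_mem hm, ih]
    · rw [if_pos hm, Finset.prod_insert (by simp), echelonCls_succ_of_notMem hm, ih, mul_comm]

end Cell

/-! ### Points of projective space in homogeneous coordinates -/

theorem eval₂_mul_of_isHomogeneous {R S N : Type*} [CommSemiring R] [CommSemiring S] (f : R →+* S)
    (v : N → S) (c : S) {g : MvPolynomial N R} {k : ℕ} (hg : g.IsHomogeneous k) :
    g.eval₂ f (fun j => c * v j) = c ^ k * g.eval₂ f v := by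
  rw [MvPolynomial.eval₂_eq, MvPolynomial.eval₂_eq, Finset.mul_sum]
  refine Finset.sum_congr rfl fun d hd => ?_
  rw [hg.degree_eq_sum_deg_support hd]
  simp only [mul_pow, Finset.prod_mul_distrib, Finset.prod_pow_eq_pow_sum]
  ring

section Chart

attribute [local instance] MvPolynomial.gradedAlgebra

open HomogeneousLocalization

variable {N : Type} {i : N}

theorem X_mem (i : N) : (MvPolynomial.X i : MvPolynomial N F) ∈
    MvPolynomial.homogeneousSubmodule N F 1 := MvPolynomial.isHomogeneous_X F i

variable {R : Type u} [CommRing R] (ψ : MvPolynomial N F →+* R) (hψ : ψ (MvPolynomial.X i) = 1)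

/-- The homomorphism `g / X_i ^ k ↦ ψ g`, where `ψ X_i = 1`. -/
def chartHom : Away (MvPolynomial.homogeneousSubmodule N F) (MvPolynomial.X i) →+* R :=
  (IsLocalization.Away.lift (S := Localization.Away (MvPolynomial.X i : MvPolynomial N F))
    (MvPolynomial.X i) (g := ψ) (by rw [hψ]; exact isUnit_one)).comp
    (algebraMap _ (Localization.Away (MvPolynomial.X i : MvPolynomial N F)))

theorem chartHom_mk {d : ℕ}
    (hd : (MvPolynomial.X i : MvPolynomial N F) ∈ MvPolynomial.homogeneousSubmodule N F d) (k : ℕ)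
    (g : MvPolynomial N F) (hg : g ∈ MvPolynomial.homogeneousSubmodule N F (k • d)) :
    chartHom ψ hψ (Away.mk _ hd k g hg) = ψ g := by
  rw [chartHom, RingHom.comp_apply, HomogeneousLocalization.algebraMap_apply, Away.val_mk,
    Localization.mk_eq_mk', IsLocalization.Away.lift, IsLocalization.lift_mk'_spec]
  simp [hψ]

/-- Take for `ψ` the dehomogenisation `g ↦ g(X_j / X_i)` followed by `χ`. It works because every
element of the degree zero localization is `g / X_i ^ k` with `g` homogeneous of degree `k`, which
is the dehomogenisation of `g`. -/
theorem exists_chartHom_eq {K : Type u} [CommRing K]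
    (χ : Away (MvPolynomial.homogeneousSubmodule N F) (MvPolynomial.X i) →+* K) :
    ∃ (ψ : MvPolynomial N F →+* K) (hψ : ψ (MvPolynomial.X i) = 1), chartHom ψ hψ = χ := by
  let A := Away (MvPolynomial.homogeneousSubmodule N F) (MvPolynomial.X i)
  let v (j : N) : A := Away.mk _ (X_mem i) 1 (MvPolynomial.X j) (X_mem j)
  let c : F →+* A := (fromZeroRingHom (MvPolynomial.homogeneousSubmodule N F) _).comp
    (algebraMap F (MvPolynomial.homogeneousSubmodule N F 0))
  let deh : MvPolynomial N F →+* A := MvPolynomial.eval₂Hom c v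
  let S := Localization.Away (MvPolynomial.X i : MvPolynomial N F)
  let w : S := algebraMap (MvPolynomial N F) S (MvPolynomial.X i)
  have hw : IsUnit w := IsLocalization.Away.algebraMap_isUnit _
  have hmk (k : ℕ) (g : MvPolynomial N F)
      (hg : g ∈ MvPolynomial.homogeneousSubmodule N F (k • 1)) (h : A)
      (hh : h = Away.mk _ (X_mem i) k g hg) : w ^ k * algebraMap A S h = algebraMap _ S g := by
    rw [hh, HomogeneousLocalization.algebraMap_apply, Away.val_mk, Localization.mk_eq_mk',
      ← map_pow, IsLocalization.mk'_spec'_mk]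
  have key (k : ℕ) (g : MvPolynomial N F)
      (hg : g ∈ MvPolynomial.homogeneousSubmodule N F (k • 1)) :
      Away.mk _ (X_mem i) k g hg = deh g := by
    apply HomogeneousLocalization.val_injective
    -- In the full localization `w = X_i` is a unit. Multiplying by `w ^ k` turns the claim into
    -- `g(w v) = w ^ k g(v)` with `w v_j = X_j`.
    refine (hw.pow k).mul_left_cancel ?_
    refine (hmk k g hg _ rfl).trans ?_
    change _ = w ^ k * algebraMap A S (deh g)
    have h1 : algebraMap A S (deh g) = g.eval₂ ((algebraMap A S).comp c)
        (fun j => algebraMap A S (v j)) := by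
      simp only [deh]
      rw [MvPolynomial.coe_eval₂Hom, MvPolynomial.eval₂_comp_left]
      rfl
    have hg' : g.IsHomogeneous k := by simpa using hg
    rw [h1, ← eval₂_mul_of_isHomogeneous _ _ _ hg']
    have h2 (j : N) : w * algebraMap A S (v j) = algebraMap (MvPolynomial N F) S (MvPolynomial.X j) := by
      have := hmk 1 (MvPolynomial.X j) (X_mem j) (v j) rfl
      rwa [pow_one] at this
    simp only [h2]
    have h3 : (algebraMap A S).comp c = (algebraMap (MvPolynomial N F) S).comp MvPolynomial.C := by
      ext r
      change (fromZeroRingHom (MvPolynomial.homogeneousSubmodule N F) _ _).val = _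
      change Localization.mk _ _ = _
      exact Localization.mk_one_eq_algebraMap _
    rw [h3]
    have h4 := MvPolynomial.eval₂_comp_left (algebraMap (MvPolynomial N F) S) MvPolynomial.C
      MvPolynomial.X g
    rw [MvPolynomial.eval₂_eta] at h4
    exact h4
  have hone : (χ.comp deh) (MvPolynomial.X i) = 1 := by
    rw [RingHom.comp_apply, ← key 1 _ (X_mem i), ← map_one χ]
    congr 1
    apply HomogeneousLocalization.val_injective
    refine hw.mul_left_cancel ?_
    have := hmk 1 _ (X_mem i) _ rfl
    rw [pow_one] at this
    rw [HomogeneousLocalization.val_one, mul_one]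
    exact this
  refine ⟨χ.comp deh, hone, RingHom.ext fun z => ?_⟩
  obtain ⟨k, g, hg, rfl⟩ := Away.mk_surjective _ (X_mem i) z
  rw [chartHom_mk, key, RingHom.comp_apply]

/-- The morphism to projective space given by homogeneous coordinates `ψ X_j` with `ψ X_i = 1`. -/
def chartMap : Spec (.of R) ⟶ Proj (MvPolynomial.homogeneousSubmodule N F) :=
  Spec.map (CommRingCat.ofHom (chartHom ψ hψ)) ≫ Proj.awayι _ _ (X_mem i) one_pos

theorem mem_basicOpen_chartMap {d : ℕ} (hd : 0 < d) {g : MvPolynomial N F}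
    (hg : g.IsHomogeneous d) (p : PrimeSpectrum R) :
    chartMap ψ hψ p ∈ Proj.basicOpen (MvPolynomial.homogeneousSubmodule N F) g ↔
      ψ g ∉ p.asIdeal := by
  have h : chartMap ψ hψ p = Proj.awayι (MvPolynomial.homogeneousSubmodule N F) _ (X_mem i)
      one_pos (PrimeSpectrum.comap (chartHom ψ hψ) p) := rfl
  have h2 := Proj.awayι_preimage_basicOpen (MvPolynomial.homogeneousSubmodule N F) (X_mem (F := F) i)
    one_pos (g_deg := (MvPolynomial.mem_homogeneousSubmodule _ _).2 hg) hd
  rw [h]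
  change PrimeSpectrum.comap (chartHom ψ hψ) p ∈ Proj.awayι
    (MvPolynomial.homogeneousSubmodule N F) _ (X_mem i) one_pos ⁻¹ᵁ Proj.basicOpen _ g ↔ _
  rw [h2]
  change chartHom ψ hψ _ ∉ p.asIdeal ↔ _
  rw [Away.isLocalizationElem, chartHom_mk, pow_one]

theorem chartMap_str {r n : ℕ} {i : Fin r → Fin n} (ψ : MvPolynomial (Fin r → Fin n) F →+* R)
    (hψ : ψ (MvPolynomial.X i) = 1) :
    chartMap ψ hψ ≫ pluckerSpaceStr F r n =
      Spec.map (CommRingCat.ofHom (ψ.comp MvPolynomial.C)) := by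
  unfold chartMap pluckerSpaceStr
  rw [Category.assoc, Proj.awayι_toSpecZero_assoc, ← Spec.map_comp, ← Spec.map_comp]
  congr 1
  refine CommRingCat.hom_ext (RingHom.ext fun c => ?_)
  change chartHom ψ hψ (fromZeroRingHom _ _ (algebraMap F _ c)) = ψ (MvPolynomial.C c)
  rw [← chartHom_mk ψ hψ (X_mem i) 0 (MvPolynomial.C c)
    (by simp)]
  congr 1

theorem SpecMap_chartMap {R' : Type u} [CommRing R'] (θ : R →+* R') :
    Spec.map (CommRingCat.ofHom θ) ≫ chartMap ψ hψ =
      chartMap (θ.comp ψ) (i := i) (by rw [RingHom.comp_apply, hψ, map_one]) := by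
  unfold chartMap
  rw [← Category.assoc, ← Spec.map_comp]
  congr 2
  refine CommRingCat.hom_ext (RingHom.ext fun z => ?_)
  obtain ⟨k, g, hg, rfl⟩ := Away.mk_surjective _ (X_mem i) z
  change θ (chartHom ψ hψ _) =
    chartHom (θ.comp ψ) (by rw [RingHom.comp_apply, hψ, map_one]) _
  rw [chartHom_mk, chartHom_mk]
  rfl

/-- Every field-valued point of projective space has homogeneous coordinates. -/
theorem exists_chartMap (x : Proj (MvPolynomial.homogeneousSubmodule N F))
    (hx : x ∈ Proj.basicOpen (MvPolynomial.homogeneousSubmodule N F) (MvPolynomial.X i)) :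
    ∃ (K : Type u) (_ : Field K) (ψ : MvPolynomial N F →+* K) (hψ : ψ (MvPolynomial.X i) = 1)
      (p : PrimeSpectrum K), chartMap ψ hψ p = x := by
  rw [← Proj.opensRange_awayι _ _ (X_mem i) one_pos] at hx
  obtain ⟨y, rfl⟩ := hx
  obtain ⟨K, _, t, p, rfl⟩ := exists_fieldPoint y
  obtain ⟨ψ, hψ, h⟩ := exists_chartHom_eq (Spec.preimage t).hom
  refine ⟨K, inferInstance, ψ, hψ, p, ?_⟩
  have : Spec.map (CommRingCat.ofHom (chartHom ψ hψ)) = t := by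
    rw [h]
    exact Spec.map_preimage t
  rw [chartMap, this]
  rfl

/-- The hypotheses put the constants and all variables in the image of `chartHom`; so the map is a
closed immersion into an affine chart, followed by an open immersion. -/
theorem isImmersion_chartMap {σ : Type} (ψ : MvPolynomial N F →+* MvPolynomial σ F)
    (hψ : ψ (MvPolynomial.X i) = 1)
    (hC : ∀ c, ψ (MvPolynomial.C c) = MvPolynomial.C c)
    (hs : ∀ k, ∃ j, ψ (MvPolynomial.X j) = MvPolynomial.X k) :
    IsImmersion (chartMap ψ hψ) := by
  have : IsClosedImmersion (Spec.map (CommRingCat.ofHom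
      (chartHom ψ hψ))) := by
    refine IsClosedImmersion.spec_of_surjective _ fun g => ?_
    change g ∈ (chartHom ψ hψ).range
    induction g using MvPolynomial.induction_on with
    | C c =>
      refine ⟨Away.mk _ (X_mem i) 0 (MvPolynomial.C c)
        (by simp), ?_⟩
      rw [chartHom_mk]
      exact hC c
    | add p q hp hq => exact add_mem hp hq
    | mul_X p k hp =>
      refine mul_mem hp ?_
      obtain ⟨j, hj⟩ := hs k
      refine ⟨Away.mk _ (X_mem i) 1 (MvPolynomial.X j) (X_mem j), ?_⟩
      rw [chartHom_mk]
      exact hj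
  unfold chartMap
  infer_instance

end Chart

end Variety

/-! ### Determinants -/

section Determinant

/-- The columns up to `a` are supported in the rows before `a`, one fewer; by pigeonhole every
permutation meets a zero entry. -/
theorem det_eq_zero_of_block {r : ℕ} {R : Type*} [CommRing R] (M : Matrix (Fin r) (Fin r) R)
    (a : Fin r) (h : ∀ c b, a ≤ c → b ≤ a → M c b = 0) : M.det = 0 := by
  rw [Matrix.det_apply]
  refine Finset.sum_eq_zero fun σ _ => ?_
  have hσ : ∃ b ≤ a, a ≤ σ b := by
    by_contra! hcon
    have := Finset.card_le_card_of_injOn (s := Finset.Iic a) (t := Finset.Iio a) σ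
      (fun b hb => by simpa using hcon b (by simpa using hb)) σ.injective.injOn
    rw [Fin.card_Iic, Fin.card_Iio] at this
    omega
  obtain ⟨b, hb, hb'⟩ := hσ
  have h0 : ∏ i, M (σ i) i = 0 := Finset.prod_eq_zero (Finset.mem_univ b) (h _ _ hb' hb)
  rw [h0, smul_zero]

theorem det_updateCol_one {r : ℕ} {R : Type*} [CommRing R] (a : Fin r) (v : Fin r → R) :
    ((1 : Matrix (Fin r) (Fin r) R).updateCol a v).det = v a := by
  rw [← Matrix.cramer_apply, Matrix.cramer_one]
  rfl

/-- Cramer's rule for the minors of a matrix. -/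
theorem det_cramer {r : ℕ} {R : Type*} [CommRing R] (A B : Matrix (Fin r) (Fin r) R) :
    (Matrix.of fun a b => (A.updateCol a fun c => B c b).det).det = A.det ^ (r - 1) * B.det := by
  have : (Matrix.of fun a b => (A.updateCol a fun c => B c b).det) = A.adjugate * B := by
    ext a b
    rw [Matrix.of_apply, ← Matrix.cramer_apply, Matrix.cramer_eq_adjugate_mulVec]
    rfl
  rw [this, Matrix.det_mul, Matrix.det_adjugate, Fintype.card_fin]

theorem isHomogeneous_det {r : ℕ} {N R : Type*} [CommRing R]
    (M : Matrix (Fin r) (Fin r) (MvPolynomial N R)) (hM : ∀ a b, (M a b).IsHomogeneous 1) :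
    M.det.IsHomogeneous r := by
  rw [Matrix.det_apply]
  refine MvPolynomial.IsHomogeneous.sum _ _ _ fun σ _ => ?_
  rw [Units.smul_def]
  have := MvPolynomial.IsHomogeneous.prod Finset.univ (fun i => M (σ i) i) (fun _ => 1)
    fun i _ => hM _ _
  rw [Finset.sum_const, Finset.card_univ, Fintype.card_fin, smul_eq_mul, mul_one] at this
  exact zsmul_mem (K := MvPolynomial.homogeneousSubmodule N R r) this _

end Determinant

namespace Variety

variable {F : Type u} [Field F]

/-! ### The Plücker relations -/

section Plucker

variable {r n : ℕ}

theorem X_mem_pluckerRelations {f : Fin r → Fin n} {a b : Fin r} (hab : a ≠ b) (h : f a = f b) :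
    MvPolynomial.X f ∈ pluckerRelations F r n := by
  refine ⟨⟨1, MvPolynomial.isHomogeneous_X _ _⟩, ?_⟩
  rw [MvPolynomial.aeval_X]
  exact Matrix.det_zero_of_column_eq hab fun k => by simp [h]

theorem X_add_X_swap_mem_pluckerRelations (f : Fin r → Fin n) {a b : Fin r} (hab : a ≠ b) :
    MvPolynomial.X f + MvPolynomial.X (f ∘ Equiv.swap a b) ∈ pluckerRelations F r n := by
  refine ⟨⟨1, (MvPolynomial.isHomogeneous_X _ _).add (MvPolynomial.isHomogeneous_X _ _)⟩, ?_⟩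
  rw [map_add, MvPolynomial.aeval_X, MvPolynomial.aeval_X]
  have := Matrix.det_permute' (Equiv.swap a b)
    (Matrix.of fun a b => (MvPolynomial.X (a, f b) : MvPolynomial (Fin r × Fin n) F))
  rw [Equiv.Perm.sign_swap hab] at this
  simp only [Units.val_neg, Units.val_one, Int.cast_neg, Int.cast_one, neg_mul, one_mul] at this
  exact (add_comm _ _).trans (eq_neg_iff_add_eq_zero.1 this)

/-- The generic minors satisfy this by `det_cramer`. Where `p_f = 1` it recovers all coordinates
from those whose tuple differs from `f` in one place. Besides it, only the vanishing for repeated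
columns and the sign under swaps are needed to describe the points. -/
theorem cramer_mem_pluckerRelations (hr : 1 ≤ r) (f g : Fin r → Fin n) :
    MvPolynomial.X f ^ (r - 1) * MvPolynomial.X g -
      (Matrix.of fun a b => (MvPolynomial.X (Function.update f a (g b)) :
        MvPolynomial (Fin r → Fin n) F)).det ∈ pluckerRelations F r n := by
  refine ⟨⟨r, MvPolynomial.IsHomogeneous.sub ?_
    (isHomogeneous_det _ fun a b => MvPolynomial.isHomogeneous_X _ _)⟩, ?_⟩
  · have := ((MvPolynomial.isHomogeneous_X F f).pow (r - 1)).mul (MvPolynomial.isHomogeneous_X F g)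
    rwa [one_mul, Nat.sub_add_cancel hr] at this
  · rw [map_sub, map_mul, map_pow, MvPolynomial.aeval_X, MvPolynomial.aeval_X, AlgHom.map_det,
      sub_eq_zero]
    unfold genericMinor
    rw [← det_cramer]
    congr 1
    ext1 a b
    rw [Matrix.of_apply, AlgHom.mapMatrix_apply, Matrix.map_apply, Matrix.of_apply,
      MvPolynomial.aeval_X]
    congr 1
    ext1 c d
    rw [Matrix.updateCol_apply]
    by_cases h : d = a
    · subst h
      simp
    · simp [h]

/-- A homomorphism on the homogeneous coordinate ring of the Plücker space that is given by the
minors of a matrix kills the Plücker relations. -/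
theorem map_pluckerRelation {R : Type*} [CommRing R] (ψ : MvPolynomial (Fin r → Fin n) F →+* R)
    (A : Fin r → Fin n → R) (h : ∀ f, ψ (MvPolynomial.X f) = (Matrix.of fun a b => A a (f b)).det)
    {g : MvPolynomial (Fin r → Fin n) F} (hg : g ∈ pluckerRelations F r n) : ψ g = 0 := by
  have : ψ = (MvPolynomial.eval₂Hom (ψ.comp MvPolynomial.C)
      (fun p : Fin r × Fin n => A p.1 p.2)).comp
      (MvPolynomial.aeval (genericMinor F) :
        MvPolynomial (Fin r → Fin n) F →ₐ[F] MvPolynomial (Fin r × Fin n) F).toRingHom := by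
    refine MvPolynomial.ringHom_ext (fun c => ?_) fun f => ?_
    · simp
    · rw [h, RingHom.comp_apply, AlgHom.toRingHom_eq_coe, RingHom.coe_coe, MvPolynomial.aeval_X,
        genericMinor,
        RingHom.map_det]
      congr 1
      ext a b
      simp
  rw [this, RingHom.comp_apply, AlgHom.toRingHom_eq_coe, RingHom.coe_coe, hg.2, map_zero]

variable {K : Type u} [Field K] {I : Fin r → Fin n} {ψ : MvPolynomial (Fin r → Fin n) F →+* K}

theorem minor_eq_of_relations (hr : 1 ≤ r) (hψ : ψ (MvPolynomial.X I) = 1)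
    (h : ∀ g ∈ pluckerRelations F r n, ψ g = 0) (f : Fin r → Fin n) :
    ψ (MvPolynomial.X f) =
      (Matrix.of fun a b => ψ (MvPolynomial.X (Function.update I a (f b)))).det := by
  have := h _ (cramer_mem_pluckerRelations hr I f)
  rw [map_sub, map_mul, map_pow, hψ, one_pow, one_mul, sub_eq_zero, RingHom.map_det] at this
  exact this

end Plucker

/-! ### Strata of the distinct column locus as echelon cells -/

section Strata

attribute [local instance] MvPolynomial.gradedAlgebra

variable {r n : ℕ}

/-- The pivot columns as natural numbers. -/
def pivots (I : Fin r → Fin n) : Fin r → ℕ := fun a => I a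

/-- The minors of the generic matrix in reduced row echelon form with pivot columns `I`. -/
def echelonHom (F : Type u) [Field F] (I : Fin r → Fin n) :
    MvPolynomial (Fin r → Fin n) F →+* MvPolynomial (FreeIdx (pivots I) n) F :=
  MvPolynomial.eval₂Hom MvPolynomial.C fun f =>
    (Matrix.of fun a b => echelonEntry (pivots I) F n a (f b)).det

theorem echelonHom_X (I f : Fin r → Fin n) : echelonHom F I (MvPolynomial.X f) =
    (Matrix.of fun a b => echelonEntry (pivots I) F n a (f b)).det := by
  simp [echelonHom]

theorem echelonHom_C (I : Fin r → Fin n) (c : F) :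
    echelonHom F I (MvPolynomial.C c) = MvPolynomial.C c := by
  simp [echelonHom]

theorem pivots_injective {I : Fin r → Fin n} (hI : Function.Injective I) :
    Function.Injective (pivots I) := fun _ _ h => hI (Fin.ext h)

/-- The pivot columns form the identity matrix, so exchanging one of them for column `j` gives a
minor equal to a single entry. This recovers the matrix from its Plücker coordinates. -/
theorem echelonHom_update {I : Fin r → Fin n} (hI : Function.Injective I) (a : Fin r)
    (j : Fin n) : echelonHom F I (MvPolynomial.X (Function.update I a j)) =
      echelonEntry (pivots I) F n a j := by
  rw [echelonHom_X, ← det_updateCol_one a fun c => echelonEntry (pivots I) F n c j]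
  congr 1
  ext1 c b
  rw [Matrix.updateCol_apply, Matrix.of_apply]
  by_cases hb : b = a
  · subst hb
    simp
  · rw [if_neg hb, Function.update_of_ne hb, Matrix.one_apply]
    by_cases hc : c = b
    · rw [if_pos hc]
      exact echelonEntry_pivot (congrArg (pivots I) hc)
    · rw [if_neg hc]
      exact echelonEntry_pivot_of_ne (pivots_injective hI) hc

theorem echelonHom_self {I : Fin r → Fin n} (hI : Function.Injective I) :
    echelonHom F I (MvPolynomial.X I) = 1 := by
  rw [echelonHom_X, ← Matrix.det_one (n := Fin r) (R := MvPolynomial (FreeIdx (pivots I) n) F)]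
  congr 1
  ext1 c b
  rw [Matrix.of_apply, Matrix.one_apply]
  by_cases hc : c = b
  · rw [if_pos hc]
    exact echelonEntry_pivot (congrArg (pivots I) hc)
  · rw [if_neg hc]
    exact echelonEntry_pivot_of_ne (pivots_injective hI) hc

/-- At the first place `a` where `f` and `I` differ, the columns `f 0, …, f a` all lie left of the
pivots of row `a` and of the rows below it; this is the zero block. -/
theorem echelonHom_of_lt {I : Fin r → Fin n} (hI : StrictMono I) {f : Fin r → Fin n}
    (hf : toLex f < toLex I) : echelonHom F I (MvPolynomial.X f) = 0 := by
  obtain ⟨a, h1, h2⟩ := hf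
  rw [echelonHom_X]
  refine det_eq_zero_of_block _ a fun c b hc hb => echelonEntry_eq_zero ?_
  change f b < I c
  rcases hb.lt_or_eq with hb | rfl
  · exact (h1 b hb).trans_lt (hI (hb.trans_le hc))
  · exact lt_of_lt_of_le h2 (hI.monotone hc)

variable (F r n) in
/-- The distinct column locus as a subset of the Plücker space. -/
def grdcSet : Set (pluckerSpace F r n) :=
  ProjectiveSpectrum.zeroLocus _ (pluckerRelations F r n) ∩ distinctColumns F r n

theorem isLocallyClosed_grdcSet : IsLocallyClosed (grdcSet F r n) :=
  (ProjectiveSpectrum.isClosed_zeroLocus _ _).isLocallyClosed.inter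
    (distinctColumns F r n).isOpen.isLocallyClosed

instance : IsClosedImmersion (grassmannianι F r n) :=
  inferInstanceAs (IsClosedImmersion (ofClosedι (pluckerSpaceStr F r n)
    ⟨ProjectiveSpectrum.zeroLocus _ (pluckerRelations F r n),
      ProjectiveSpectrum.isClosed_zeroLocus _ _⟩))

theorem range_grassmannianι : Set.range (grassmannianι F r n) =
    ProjectiveSpectrum.zeroLocus _ (pluckerRelations F r n) :=
  range_ofClosedι (pluckerSpaceStr F r n)
    ⟨ProjectiveSpectrum.zeroLocus _ (pluckerRelations F r n),
      ProjectiveSpectrum.isClosed_zeroLocus _ _⟩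

theorem cls_grdc : cls (grdc F r n) = locCls (pluckerSpaceStr F r n) (grdcSet F r n) := by
  rw [grdc, cls_eq_locCls (pluckerSpaceStr F r n) _
    (openSubι (grassmannian F r n) (grassmannianι F r n ⁻¹ᵁ distinctColumns F r n) ≫
      grassmannianι F r n) rfl, range_comp, range_openSubι]
  congr 1
  refine (Set.image_preimage_eq_inter_range (f := grassmannianι F r n)
    (t := distinctColumns F r n)).trans ?_
  rw [range_grassmannianι]
  exact Set.inter_comm _ _

section FieldPoint

variable {K : Type u} [Field K] {I : Fin r → Fin n} (ψ : MvPolynomial (Fin r → Fin n) F →+* K)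
  (hψ : ψ (MvPolynomial.X I) = 1) (p : PrimeSpectrum K)

theorem chartMap_mem_basicOpen_iff {d : ℕ} (hd : 0 < d) {g : MvPolynomial (Fin r → Fin n) F}
    (hg : g.IsHomogeneous d) :
    chartMap ψ hψ p ∈ Proj.basicOpen (MvPolynomial.homogeneousSubmodule (Fin r → Fin n) F) g ↔
      ψ g ≠ 0 := by
  rw [mem_basicOpen_chartMap _ _ hd hg, Subsingleton.elim p ⊥]
  rfl

theorem chartMap_mem_basicOpen_X (f : Fin r → Fin n) :
    chartMap ψ hψ p ∈ Proj.basicOpen (MvPolynomial.homogeneousSubmodule (Fin r → Fin n) F)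
      (MvPolynomial.X f) ↔ ψ (MvPolynomial.X f) ≠ 0 :=
  chartMap_mem_basicOpen_iff ψ hψ p one_pos (MvPolynomial.isHomogeneous_X _ _)

theorem chartMap_mem_zeroLocus_iff :
    chartMap ψ hψ p ∈ ProjectiveSpectrum.zeroLocus
      (MvPolynomial.homogeneousSubmodule (Fin r → Fin n) F) (pluckerRelations F r n) ↔
    ∀ g ∈ pluckerRelations F r n, ψ g = 0 := by
  refine (ProjectiveSpectrum.mem_zeroLocus _ _ _).trans
    (forall_congr' fun g => imp_congr_right fun hg => ?_)
  obtain ⟨⟨d, hd⟩, hg0⟩ := hg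
  -- The criterion by basic opens needs positive degree. A relation of degree 0 is a constant that
  -- maps to 0, so it is 0.
  rcases Nat.eq_zero_or_pos d with rfl | hd'
  · have hgC := MvPolynomial.totalDegree_eq_zero_iff_eq_C.1 (Nat.le_zero.1 hd.totalDegree_le)
    have : g = 0 := by
      rw [hgC, MvPolynomial.aeval_C] at hg0
      have h0 : g.coeff 0 = 0 := (MvPolynomial.C_injective _ _) (hg0.trans (map_zero _).symm)
      rw [hgC, h0, map_zero]
    rw [this, map_zero]
    exact ⟨fun _ => rfl, fun _ => zero_mem _⟩
  · have := chartMap_mem_basicOpen_iff ψ hψ p hd' hd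
    rw [Proj.mem_basicOpen] at this
    exact not_iff_not.1 this

theorem chartMap_mem_distinctColumns_iff :
    chartMap ψ hψ p ∈ distinctColumns F r n ↔
      (∀ i : Fin n, ∃ f : Fin r → Fin n, i ∈ Set.range f ∧ ψ (MvPolynomial.X f) ≠ 0) ∧
      ∀ i j : Fin n, i ≠ j → ∃ (f : Fin r → Fin n) (a : Fin r),
        ψ (MvPolynomial.X (Function.update f a i)) ≠
          ψ (MvPolynomial.X (Function.update f a j)) := by
  refine and_congr (forall_congr' fun i => exists_congr fun f => and_congr_right fun _ =>
    chartMap_mem_basicOpen_X ψ hψ p f) (forall_congr' fun i => forall_congr' fun j =>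
      imp_congr_right fun _ => exists_congr fun f => exists_congr fun a => ?_)
  refine (chartMap_mem_basicOpen_iff ψ hψ p one_pos
    ((MvPolynomial.isHomogeneous_X _ _).sub (MvPolynomial.isHomogeneous_X _ _))).trans ?_
  rw [map_sub, sub_ne_zero]

end FieldPoint

/-- The part of the distinct column locus where `I` is the lexicographically first tuple of columns
with a nonzero minor. -/
def stratum (F : Type u) [Field F] (I : Fin r → Fin n) : Set (pluckerSpace F r n) :=
  {x ∈ grdcSet F r n | x ∈ Proj.basicOpen _ (MvPolynomial.X (R := F) I) ∧
    ∀ J, toLex J < toLex I → x ∉ Proj.basicOpen _ (MvPolynomial.X (R := F) J)}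

/-- If `I` has an inversion, swapping it gives a lexicographically smaller tuple whose coordinate is
the same up to sign; if `I` repeats a column, its coordinate vanishes. -/
theorem stratum_eq_empty {I : Fin r → Fin n} (hI : ¬ StrictMono I) : stratum F I = ∅ := by
  refine Set.eq_empty_of_forall_notMem fun x hx => ?_
  obtain ⟨⟨hx1, -⟩, hx2, hx3⟩ := hx
  obtain ⟨K, _, ψ, hψ, p, rfl⟩ := exists_chartMap x hx2
  replace hx1 := (chartMap_mem_zeroLocus_iff ψ hψ p).1 hx1
  simp only [StrictMono, not_forall, not_lt] at hI
  obtain ⟨a, b, hab, hI⟩ := hI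
  rcases hI.lt_or_eq with hlt | heq
  · have h1 := hx1 _ (X_add_X_swap_mem_pluckerRelations I hab.ne)
    have h2 := hx3 (I ∘ Equiv.swap a b) ⟨a, fun i hi => by
      simp [Equiv.swap_apply_of_ne_of_ne hi.ne (hi.trans hab).ne], by simpa using hlt⟩
    replace h2 := not_not.1 ((chartMap_mem_basicOpen_X ψ hψ p _).not.1 h2)
    rw [map_add, hψ, h2, add_zero] at h1
    exact one_ne_zero h1
  · have h1 := hx1 _ (X_mem_pluckerRelations hab.ne heq.symm)
    rw [hψ] at h1
    exact one_ne_zero h1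

/-- Zero or equal columns force zero or equal minors. Conversely, the minors on `I` with one column
exchanged are the matrix entries, so they detect a nonzero or different column. -/
theorem echelonHom_mem_distinct_iff {I : Fin r → Fin n} (hI : StrictMono I) {K : Type u} [Field K]
    (φ : MvPolynomial (FreeIdx (pivots I) n) F →+* K) :
    ((∀ i : Fin n, ∃ f : Fin r → Fin n, i ∈ Set.range f ∧
        φ (echelonHom F I (MvPolynomial.X f)) ≠ 0) ∧
      ∀ i j : Fin n, i ≠ j → ∃ (f : Fin r → Fin n) (a : Fin r),
        φ (echelonHom F I (MvPolynomial.X (Function.update f a i))) ≠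
          φ (echelonHom F I (MvPolynomial.X (Function.update f a j)))) ↔
    homPt φ ∈ echelonOpen (pivots I) F n := by
  rw [homPt_mem_echelonOpen]
  constructor
  · rintro ⟨h1, h2⟩
    refine ⟨fun j hj => ?_, fun i hi j hj hij => ?_⟩
    · obtain ⟨f, ⟨b, hb⟩, hf⟩ := h1 ⟨j, hj⟩
      by_contra! hcon
      refine hf ?_
      rw [echelonHom_X, RingHom.map_det]
      refine Matrix.det_eq_zero_of_column_eq_zero b fun a => ?_
      simpa [hb] using hcon a
    · obtain ⟨f, a, hf⟩ := h2 ⟨i, hi⟩ ⟨j, hj⟩ fun h => hij (congrArg Fin.val h)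
      by_contra! hcon
      refine hf ?_
      rw [echelonHom_X, echelonHom_X, RingHom.map_det, RingHom.map_det]
      congr 1
      ext c b
      by_cases hb : b = a
      · subst hb
        simpa using hcon c
      · simp [hb]
  · rintro ⟨h1, h2⟩
    refine ⟨fun j => ?_, fun i j hij => ?_⟩
    · obtain ⟨a, ha⟩ := h1 j j.2
      exact ⟨Function.update I a j, ⟨a, by simp⟩, by rwa [echelonHom_update hI.injective]⟩
    · obtain ⟨a, ha⟩ := h2 i i.2 j j.2 fun h => hij (Fin.ext h)
      exact ⟨I, a, by rwa [echelonHom_update hI.injective, echelonHom_update hI.injective]⟩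

variable (F) in
/-- The matrix in reduced row echelon form with pivot columns `I`, as a point of the Grassmannian. -/
def echelonMap {I : Fin r → Fin n} (hI : Function.Injective I) :
    (affVar F (FreeIdx (pivots I) n)).X ⟶ pluckerSpace F r n :=
  chartMap (echelonHom F I) (echelonHom_self hI)

theorem echelonMap_homPt {I : Fin r → Fin n} (hI : Function.Injective I) {K : Type u} [Field K]
    (φ : MvPolynomial (FreeIdx (pivots I) n) F →+* K) (p : PrimeSpectrum K) :
    echelonMap F hI (homPt φ) = chartMap (φ.comp (echelonHom F I)) (i := I)
      (by rw [RingHom.comp_apply, echelonHom_self hI, map_one]) p := by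
  rw [← SpecMap_chartMap (echelonHom F I) (echelonHom_self hI), ← homSpec_apply φ p]
  rfl

/-- The content is that every point of the stratum comes from an echelon matrix. Normalise `p_I = 1`
and let the entry at `(a, j)` be the coordinate of `I` with `I a` replaced by `j`: lexicographic
minimality and the vanishing for repeated columns make it echelon, and Cramer's relations make all
coordinates its minors. -/
theorem image_echelonMap (hr : 1 ≤ r) {I : Fin r → Fin n} (hI : StrictMono I) :
    echelonMap F hI.injective '' (echelonOpen (pivots I) F n) = stratum F I := by
  have hcomp {K : Type u} [Field K] (φ : MvPolynomial (FreeIdx (pivots I) n) F →+* K)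
      (p : PrimeSpectrum K) := echelonMap_homPt hI.injective φ p
  apply Set.Subset.antisymm
  · rintro _ ⟨x, hx, rfl⟩
    obtain ⟨K, _, t, p, rfl⟩ := exists_fieldPoint (T := (affVar F (FreeIdx (pivots I) n)).X) x
    obtain ⟨φ, rfl⟩ := homSpec_surjective t
    rw [homSpec_apply] at hx ⊢
    rw [hcomp φ p]
    refine ⟨⟨?_, ?_⟩, ?_, fun J hJ => ?_⟩
    · refine (chartMap_mem_zeroLocus_iff _ _ p).2 fun g hg => ?_
      refine map_pluckerRelation _ (fun a j => φ (echelonEntry (pivots I) F n a j)) (fun f => ?_) hg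
      rw [RingHom.comp_apply, echelonHom_X, RingHom.map_det]
      rfl
    · exact (chartMap_mem_distinctColumns_iff _ _ p).2 ((echelonHom_mem_distinct_iff hI φ).2 hx)
    · refine (chartMap_mem_basicOpen_X _ _ p _).2 ?_
      rw [RingHom.comp_apply, echelonHom_self hI.injective, map_one]
      exact one_ne_zero
    · refine (chartMap_mem_basicOpen_X _ _ p _).not.2 (not_not.2 ?_)
      rw [RingHom.comp_apply, echelonHom_of_lt hI hJ, map_zero]
  · rintro x ⟨⟨hx1, hx4⟩, hx2, hx3⟩
    obtain ⟨K, _, ψ, hψ, p, rfl⟩ := exists_chartMap x hx2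
    replace hx1 := (chartMap_mem_zeroLocus_iff ψ hψ p).1 hx1
    have hx4' := (chartMap_mem_distinctColumns_iff _ _ p).1 hx4
    let A (a : Fin r) (j : Fin n) : K := ψ (MvPolynomial.X (Function.update I a j))
    have hA := minor_eq_of_relations hr hψ hx1
    let φ : MvPolynomial (FreeIdx (pivots I) n) F →+* K :=
      MvPolynomial.eval₂Hom (ψ.comp MvPolynomial.C) fun q => A q.1.1 ⟨q.1.2, q.2.1⟩
    have hφ (a : Fin r) (j : Fin n) : φ (echelonEntry (pivots I) F n a j) = A a j := by
      by_cases h1 : I a = j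
      · rw [echelonEntry_pivot (I := pivots I) (congrArg Fin.val h1), map_one]
        simp only [A]
        rw [← h1, Function.update_eq_self, hψ]
      · rcases lt_or_gt_of_ne h1 with h2 | h2
        · by_cases h3 : ∃ b, I b = j
          · obtain ⟨b, rfl⟩ := h3
            have hab : a ≠ b := fun h => h1 (congrArg I h)
            refine (congrArg φ (echelonEntry_pivot_of_ne (pivots_injective hI.injective)
              hab)).trans ?_
            -- Putting the pivot column `I b` in place `a` repeats a column, so the coordinate
            -- vanishes.
            rw [map_zero]
            refine (hx1 _ (X_mem_pluckerRelations hab ?_)).symm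
            simp [hab.symm]
          · have h3' : (j : ℕ) ∉ Set.range (pivots I) := by
              rintro ⟨b, hb⟩
              exact h3 ⟨b, Fin.ext hb⟩
            refine (congrArg φ (echelonEntry_free
              (⟨(a, j), j.2, h2, h3'⟩ : FreeIdx (pivots I) n))).trans ?_
            simp [φ]
        · rw [echelonEntry_eq_zero (show (j : ℕ) < pivots I a from h2), map_zero]
          -- Left of the pivot, the replaced tuple is lexicographically smaller than `I`, so its
          -- coordinate vanishes.
          have := hx3 (Function.update I a j) ⟨a, fun i hi => by
            simp [hi.ne], by simpa using h2⟩
          exact (not_not.1 ((chartMap_mem_basicOpen_X ψ hψ p _).not.1 this)).symm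
    have hcompψ : φ.comp (echelonHom F I) = ψ := by
      refine MvPolynomial.ringHom_ext (fun c => ?_) fun f => ?_
      · rw [RingHom.comp_apply, echelonHom_C]
        simp [φ]
      · rw [hA, RingHom.comp_apply, echelonHom_X, RingHom.map_det]
        congr 1
        ext a b
        exact hφ a (f b)
    refine ⟨homPt φ, ?_, ?_⟩
    · refine (echelonHom_mem_distinct_iff hI φ).1 ?_
      simpa only [← hcompψ, RingHom.comp_apply] using hx4'
    · rw [hcomp φ p]
      congr 1
      simp only [hcompψ]

theorem locCls_stratum (hr : 1 ≤ r) {I : Fin r → Fin n} (hI : StrictMono I) :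
    locCls (pluckerSpaceStr F r n) (stratum F I) = echelonCls (pivots I) F n := by
  have hψ := echelonHom_self (F := F) hI.injective
  let j := echelonMap F hI.injective
  -- Each free entry is itself a minor, hence in the image.
  have hj : IsImmersion j := isImmersion_chartMap _ hψ (echelonHom_C I) fun k =>
    ⟨Function.update I k.1.1 ⟨k.1.2, k.2.1⟩, by
      rw [echelonHom_update hI.injective]
      exact echelonEntry_free k⟩
  have hstr : j ≫ pluckerSpaceStr F r n = (affVar F (FreeIdx (pivots I) n)).str := by
    refine (chartMap_str _ hψ).trans ?_
    refine congrArg (fun g => Spec.map (CommRingCat.ofHom g)) (RingHom.ext fun c => ?_)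
    exact echelonHom_C I c
  rw [echelonCls, cls_eq_locCls (pluckerSpaceStr F r n) _
    (openSubι _ (echelonOpen (pivots I) F n) ≫ j)
    (by rw [Category.assoc, hstr, openSubι_str]), range_comp, range_openSubι,
    ← image_echelonMap hr hI]

variable (F) in
/-- The open subset of the Plücker space where a coordinate does not vanish. -/
def coordOpen (J : Lex (Fin r → Fin n)) : Set (pluckerSpace F r n) :=
  {x | x ∈ Proj.basicOpen _ (MvPolynomial.X (R := F) (ofLex J))}

theorem isOpen_coordOpen (J : Lex (Fin r → Fin n)) : IsOpen (coordOpen F J) :=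
  (Proj.basicOpen _ _).isOpen

open Classical in
theorem cls_grdc_eq_sum (hr : 1 ≤ r) (hn : 1 ≤ n) :
    cls (grdc F r n) = ∑ I : Fin r → Fin n with StrictMono I, echelonCls (pivots I) F n := by
  have hcover : grdcSet F r n ∩ ⋃ J ∈ (Finset.univ : Finset (Lex (Fin r → Fin n))),
      coordOpen F J = grdcSet F r n := by
    refine Set.inter_eq_left.2 fun x hx => ?_
    -- Column 0 is nonzero, so it is involved in some nonvanishing minor: the coordinate opens cover
    -- the locus.
    obtain ⟨f, -, hf⟩ := hx.2.1 ⟨0, hn⟩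
    exact Set.mem_biUnion (Finset.mem_univ (toLex f)) hf
  rw [cls_grdc, ← hcover, locCls_eq_sum (pluckerSpaceStr F r n) (coordOpen F) isOpen_coordOpen
    isLocallyClosed_grdcSet, Finset.sum_filter]
  refine Finset.sum_congr rfl fun I _ => ?_
  have h : {x ∈ grdcSet F r n | x ∈ coordOpen F I ∧
      ∀ J ∈ (Finset.univ : Finset (Lex (Fin r → Fin n))), J < I → x ∉ coordOpen F J} =
      stratum F (ofLex I) := by
    ext x
    exact and_congr_right fun _ => and_congr_right fun _ =>
      ⟨fun h J => h (toLex J) (Finset.mem_univ _), fun h J _ => h (ofLex J)⟩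
  refine (congrArg _ h).trans ?_
  split_ifs with hI
  · exact locCls_stratum hr hI
  · exact (congrArg _ (stratum_eq_empty hI)).trans (locCls_empty _)

end Strata

end Variety

/-! ### The recursion for sums over pivot sets -/

section Counting

variable {R : Type*} [CommRing R]

/-- The sum, over all sets `s` of `r` pivot columns, of the classes of the loci of matrices with `n`
nonzero and pairwise distinct columns in reduced row echelon form with pivot columns `s`. -/
def echelonSum (L : R) (r n : ℕ) : R :=
  ∑ s ∈ (Finset.range n).powersetCard r,
    ∏ c ∈ Finset.range n \ s, (L ^ (s.filter (· < c)).card - ((c + 1 : ℕ) : R))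

theorem echelonSum_of_lt (L : R) {r n : ℕ} (h : n < r) : echelonSum L r n = 0 := by
  rw [echelonSum, Finset.powersetCard_eq_empty.2 (by simpa using h), Finset.sum_empty]

/-- Split by whether `n` is a pivot. If not, all `r + 1` pivots are left of column `n`, which
contributes its factor; if it is, dropping it changes no factor of a column `c < n`. -/
theorem echelonSum_succ (L : R) (r n : ℕ) : echelonSum L (r + 1) (n + 1) =
    echelonSum L (r + 1) n * (L ^ (r + 1) - ((n + 1 : ℕ) : R)) + echelonSum L r n := by
  have hn : n ∉ Finset.range n := Finset.notMem_range_self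
  have hns {s : Finset ℕ} (hs : s ⊆ Finset.range n) : n ∉ s := fun h => hn (hs h)
  rw [echelonSum, Finset.range_add_one, Finset.powersetCard_succ_insert hn,
    Finset.sum_union, Finset.sum_image, echelonSum, echelonSum, Finset.sum_mul]
  · congr 1
    · refine Finset.sum_congr rfl fun s hs => ?_
      obtain ⟨hs, hcard⟩ := Finset.mem_powersetCard.1 hs
      rw [Finset.insert_sdiff_of_notMem _ (hns hs), Finset.prod_insert (by simp), mul_comm,
        Finset.filter_true_of_mem fun c hc => Finset.mem_range.1 (hs hc), hcard]
    · refine Finset.sum_congr rfl fun s hs => ?_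
      obtain ⟨hs, hcard⟩ := Finset.mem_powersetCard.1 hs
      rw [Finset.insert_sdiff_insert, Finset.sdiff_insert_of_notMem hn]
      refine Finset.prod_congr rfl fun c hc => ?_
      have hc : c < n := Finset.mem_range.1 (Finset.mem_sdiff.1 hc).1
      rw [Finset.filter_insert, if_neg (by omega)]
  · intro s hs t ht h
    have hs := (Finset.mem_powersetCard.1 hs).1
    have ht := (Finset.mem_powersetCard.1 ht).1
    rw [← Finset.erase_insert (hns hs), ← Finset.erase_insert (hns ht)]
    exact congrArg (Finset.erase · n) h
  · refine Finset.disjoint_left.2 fun s hs ht => ?_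
    obtain ⟨t, -, rfl⟩ := Finset.mem_image.1 ht
    exact hns (Finset.mem_powersetCard.1 hs).1 (Finset.mem_insert_self _ _)

/-- `k - 1` is the largest pivot. In the induction the recursion multiplies the old terms by the
factor of the new column, and the case where that column is a pivot is the new term `k = n + 1`,
with empty product. -/
theorem echelonSum_eq_sum (L : R) (r n : ℕ) : echelonSum L (r + 1) n =
    ∑ k ∈ Finset.Icc (r + 1) n,
      echelonSum L r (k - 1) * ∏ j ∈ Finset.Icc (k + 1) n, (L ^ (r + 1) - (j : R)) := by
  induction n with
  | zero => rw [echelonSum_of_lt L (by omega), Finset.Icc_eq_empty (by omega), Finset.sum_empty]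
  | succ n ih =>
    rcases Nat.lt_or_ge n r with h | h
    · rw [echelonSum_of_lt L (by omega), Finset.Icc_eq_empty (by omega), Finset.sum_empty]
    · rw [echelonSum_succ, ih, Finset.sum_Icc_succ_top (by omega), Finset.sum_mul,
        Finset.Icc_eq_empty (a := n + 1 + 1) (by omega), Finset.prod_empty, mul_one,
        Nat.add_sub_cancel]
      congr 1
      refine Finset.sum_congr rfl fun k hk => ?_
      rw [Finset.prod_Icc_succ_top (by have := (Finset.mem_Icc.1 hk).2; omega), mul_assoc]

end Counting

/-! ### Both sides as polynomials in the class of the affine line -/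

namespace Variety

variable {F : Type u} [Field F]

theorem sum_strictMono_eq_echelonSum {R : Type*} [CommRing R] (L : R) (r n : ℕ)
    [DecidablePred fun I : Fin r → Fin n => StrictMono I] (g : (Fin r → ℕ) → R)
    (hg : ∀ I : Fin r → ℕ, StrictMono I → g I = ∏ c ∈ Finset.range n \ Finset.univ.image I,
      (L ^ ((Finset.univ.image I).filter (· < c)).card - ((c + 1 : ℕ) : R))) :
    ∑ I : Fin r → Fin n with StrictMono I, g (pivots I) = echelonSum L r n := by
  refine Finset.sum_bij (fun I _ => Finset.univ.image (pivots I)) (fun I hI => ?_)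
    (fun I hI J hJ h => ?_) (fun s hs => ?_) fun I hI => ?_
  · have hI := (Finset.mem_filter.1 hI).2
    refine Finset.mem_powersetCard.2 ⟨Finset.image_subset_iff.2 fun a _ =>
      Finset.mem_range.2 (I a).2, ?_⟩
    rw [Finset.card_image_of_injective _ (pivots_injective hI.injective), Finset.card_univ,
      Fintype.card_fin]
  · have hI : StrictMono (pivots I) := (Finset.mem_filter.1 hI).2
    have hJ : StrictMono (pivots J) := (Finset.mem_filter.1 hJ).2
    have := (StrictMono.range_inj hI hJ).1 (by
      simpa using congrArg (fun s : Finset ℕ => (s : Set ℕ)) h)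
    exact funext fun a => Fin.ext (congrFun this a)
  · obtain ⟨hs, hcard⟩ := Finset.mem_powersetCard.1 hs
    refine ⟨fun a => ⟨s.orderEmbOfFin hcard a,
      Finset.mem_range.1 (hs (Finset.orderEmbOfFin_mem s hcard a))⟩, ?_, ?_⟩
    · exact Finset.mem_filter.2 ⟨Finset.mem_univ _, fun a b h =>
        (s.orderEmbOfFin hcard).strictMono h⟩
    · exact Finset.image_orderEmbOfFin_univ s hcard
  · exact hg _ (Finset.mem_filter.1 hI).2

theorem cls_grdc_eq_echelonSum {r n : ℕ} (hr : 1 ≤ r) (hn : 1 ≤ n) :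
    cls (grdc F r n) = echelonSum (cls (affineSpace F 1)) r n := by
  classical
  rw [cls_grdc_eq_sum hr hn]
  refine sum_strictMono_eq_echelonSum _ r n (fun I => echelonCls I F n) fun I hI => ?_
  rw [echelonCls_eq_prod]
  refine Finset.prod_congr ?_ fun c _ => ?_
  · ext c
    simp
  · congr 2
    rw [Nat.card_eq_fintype_card, Fintype.card_subtype, Finset.filter_image,
      Finset.card_image_of_injective _ hI.injective]

/-- Removed points and points already chosen are subtracted alike: the factor for the next point is
`L ^ d - k - j`. -/
theorem cls_conf_affineMinus {d m k : ℕ} (S : Finset (Fin d → F)) (hS : S.card = k) :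
    cls (conf m (affineMinus S)) = ∏ j ∈ Finset.Ico k (k + m),
      (cls (affineSpace F 1) ^ d - (j : K0 F)) := by
  rw [cls_conf, cls_affineMinus, cls_affineSpace, hS, Finset.prod_Ico_eq_prod_range,
    Nat.add_sub_cancel_left]
  refine Finset.prod_congr rfl fun j _ => ?_
  push_cast
  ring

end Variety

end KZero

end

theorem proposition4p2 {F : Type u} [Field F] [Finite F] (r n : ℕ) (hr : 1 ≤ r) (hn : r + 1 ≤ n)
    -- for each `k`, a set of `k + 1` points of `F ^ (r + 1)`, as long as there are enough points
    (S : ℕ → Finset (Fin (r + 1) → F))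
    (hS : ∀ k ∈ Finset.Icc (r + 1) n, k + 1 ≤ Nat.card F ^ (r + 1) → (S k).card = k + 1) :
    KZero.cls (KZero.Variety.grdc F (r + 1) n) =
      ∑ k ∈ Finset.Icc (r + 1) n, KZero.cls (KZero.Variety.grdc F r (k - 1)) *
        (if k + 1 ≤ Nat.card F ^ (r + 1) then
          KZero.cls (KZero.Variety.conf (n - k) (KZero.Variety.affineMinus (S k)))
        else
          ∏ j ∈ Finset.Icc (k + 1) n,
            (KZero.cls (KZero.Variety.affineSpace F 1) ^ (r + 1) - (j : KZero.K0 F))) := by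
  rw [KZero.Variety.cls_grdc_eq_echelonSum (by omega) (by omega), KZero.echelonSum_eq_sum]
  refine Finset.sum_congr rfl fun k hk => ?_
  have hk' := Finset.mem_Icc.1 hk
  -- Here `k - 1 ≥ r ≥ 1`, as the covering of the locus by coordinate opens requires.
  rw [KZero.Variety.cls_grdc_eq_echelonSum hr (by omega)]
  congr 1
  split_ifs with h
  · rw [KZero.Variety.cls_conf_affineMinus _ (hS k hk h)]
    -- As `k ≤ n`, the range from `k + 1` up to but excluding `(k + 1) + (n - k)` is `k + 1, …, n`.
    refine Finset.prod_congr ?_ fun _ _ => rfl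
    ext j
    rw [Finset.mem_Icc, Finset.mem_Ico]
    omega
  · rfl
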